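/- Let $n,d$ be natural numbers and let $\mathbb S^{d-1}=\{y\in\mathbb R^d:\|y\|=1\}$. For each $i\in\mathcal V=\{1,\dots,n\}$ let $\mathcal N_i:\mathbb R\to 2^{\mathcal V}$ be piecewise constant and right-continuous, and suppose there is $\tau_D>0$ such that for every $i$ any two distinct discontinuity times of $\mathcal N_i$ are more than $\tau_D$ apart. Let $\mathcal G(t)$ be the directed graph on $\mathcal V$ with edge set $\{(i,j): j\in\mathcal N_i(t)\}$. Suppose $\mathcal G$ is uniformly quasi-strongly connected: there is $T_0>0$ such that for every $t\in\mathbb R$ the union graph $\bigcup_{s\in[t,t+T_0)}\mathcal G(s)$ has a node $r$ to which there is a directed path from every other node. For $i,j\in\mathcal V$ let $f_{ij}:\mathbb R\to\mathbb R$ be Lipschitz with $f_{ij}(s)>0$ for all $s>0$. Consider the system $$\dot x_i=(I-x_ix_i^T)\sum_{j\in\mathcal N_i(t)}f_{ij}(\|x_j-x_i\|)(x_j-x_i),\qquad i\in\mathcal V,\ t\ge 0,\qquad x(0)=x_0,$$ where a solution is continuous on $[0,\infty)$ and satisfies the equation at every $t\ge0$ with the right derivative. Let $\mathcal A=\{x\in(\mathbb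 S^{d-1})^n: x_i=x_j\text{ for all }i,j\}$, and let $\operatorname{dist}(x,\mathcal A)=\inf_{w\in\mathcal A}\|w-x\|$ with the Euclidean norm of $\mathbb R^{nd}$. Then for every closed ball $B=\{y\in\mathbb S^{d-1}:\|y-c\|\le r\}$, $c\in\mathbb S^{d-1}$, that is contained in an open hemisphere $\{w\in\mathbb S^{d-1}: w^Tv>0\}$, $v\in\mathbb S^{d-1}$, the set $\mathcal A$ is globally uniformly asymptotically stable relative to $B^n$. That is, $B^n$ is compact and forward invariant (from every $x_0\in B^n$ a solution on $[0,\infty)$ exists, and every such solution stays in $B^n$), and 1. for every $\epsilon>0$ there is $T>0$ such that every solution with $x_0\in B^n$ satisfies $\operatorname{dist}(x(T),\mathcal A)\le\epsilon$; 2. for every $\epsilon>0$ there is $\delta>0$ such that every solution with $x_0\in B^n$ and $\operatorname{dist}(x_0,\mathcal A)\le\delta$ satisfies $\operatorname{dist}(x(t),\mathcal A)\le\epsilon$ for all $t\ge0$. -/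

import Mathlib

open Filter Topology

noncomputable section

namespace SphereConsensus

/-! ### Time-varying directed graphs -/

/-- A time-varying directed graph on the nodes `Fin n`, given by the neighbourhoods `N i t`: the
pair `(i, j)` is an edge at time `t` iff `j ∈ N i t`. Each `N i` is right-continuous (the finite
set of values being discrete) and there is a positive lower bound for the distance between two
distinct discontinuities of the same `N i`; in particular `N i` is piecewise constant. -/
structure SwitchingDigraph (n : ℕ) where
  /-- the neighbourhood of agent `i` at time `t` -/
  N : Fin n → ℝ → Finset (Fin n)
  right_continuous : ∀ i t, ∀ᶠ s in 𝓝[≥] t, N i s = N i t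
  dwell_time : ∃ τ : ℝ, 0 < τ ∧ ∀ i, ∀ s t : ℝ, s < t →
    (¬ ∀ᶠ r in 𝓝 s, N i r = N i s) → (¬ ∀ᶠ r in 𝓝 t, N i r = N i t) → τ < t - s

/-- The edge relation of the union graph over the time interval `[t₁, t₂)`. -/
def SwitchingDigraph.UnionEdge {n : ℕ} (G : SwitchingDigraph n) (t₁ t₂ : ℝ) (i j : Fin n) : Prop :=
  ∃ t ∈ Set.Ico t₁ t₂, j ∈ G.N i t

/-- A directed graph is quasi-strongly connected if there is a root node `r` such that from every
node there is a directed path to `r`. -/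
def QuasiStronglyConnected {n : ℕ} (E : Fin n → Fin n → Prop) : Prop :=
  ∃ r : Fin n, ∀ i : Fin n, Relation.ReflTransGen E i r

/-- For some `T > 0` every union graph over `[t, t + T)` is quasi-strongly connected. -/
def SwitchingDigraph.UniformlyQuasiStronglyConnected {n : ℕ} (G : SwitchingDigraph n) : Prop :=
  ∃ T : ℝ, 0 < T ∧ ∀ t : ℝ, QuasiStronglyConnected (G.UnionEdge t (t + T))

/-! ### The closed-loop system -/

/-- `n` stacked vectors of `ℝᵈ`, with the Euclidean norm of `ℝⁿᵈ`. -/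
abbrev State (n d : ℕ) : Type := PiLp 2 (fun _ : Fin n => EuclideanSpace ℝ (Fin d))

/-- The unit sphere of `ℝᵈ`. -/
def unitSphere (d : ℕ) : Set (EuclideanSpace ℝ (Fin d)) := {y | ‖y‖ = 1}

/-- `tangentProj x y = (I - x xᵀ) y`. -/
def tangentProj {d : ℕ} (x y : EuclideanSpace ℝ (Fin d)) : EuclideanSpace ℝ (Fin d) :=
  y - (inner ℝ x y) • x

/-- The right-hand side for agent `i` with current neighbourhood `Ni`:
`(I - xᵢ xᵢᵀ) ∑ j ∈ Ni, fᵢⱼ(‖xⱼ - xᵢ‖) (xⱼ - xᵢ)`. -/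
def velocity {n d : ℕ} (f : Fin n → Fin n → ℝ → ℝ) (Ni : Finset (Fin n)) (x : State n d)
    (i : Fin n) : EuclideanSpace ℝ (Fin d) :=
  tangentProj (x i) (∑ j ∈ Ni, f i j ‖x j - x i‖ • (x j - x i))

/-- `x` solves the closed-loop system on `[0, ∞)` with initial state `x₀` at time `0`: it is
continuous, and its right derivative at every `t ≥ 0` is the right-hand side. As the neighbourhoods
are piecewise constant and right-continuous in time, this is the same as the integral equation, and
as the differential equation off the switching times together with continuity. -/
def IsSolution {n d : ℕ} (G : SwitchingDigraph n) (f : Fin n → Fin n → ℝ → ℝ) (x₀ : State n d)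
    (x : ℝ → State n d) : Prop :=
  x 0 = x₀ ∧ ContinuousOn x (Set.Ici 0) ∧
    ∀ t : ℝ, 0 ≤ t → ∀ i : Fin n,
      HasDerivWithinAt (fun s => x s i) (velocity f (G.N i t) (x t) i) (Set.Ici t) t

/-! ### Stability notions -/

/-- The product `Bⁿ`. -/
def power {d : ℕ} (n : ℕ) (B : Set (EuclideanSpace ℝ (Fin d))) : Set (State n d) :=
  {x | ∀ i, x i ∈ B}

/-- The consensus set in `(𝕊ᵈ⁻¹)ⁿ`. -/
def consensusSet (n d : ℕ) : Set (State n d) :=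
  {x | (∀ i, x i ∈ unitSphere d) ∧ ∀ i j, x i = x j}

/-- From every initial state in `S` the system evolves for all future times, and stays in `S`. -/
def ForwardInvariant {n d : ℕ} (G : SwitchingDigraph n) (f : Fin n → Fin n → ℝ → ℝ)
    (S : Set (State n d)) : Prop :=
  ∀ x₀ ∈ S, (∃ x : ℝ → State n d, IsSolution G f x₀ x) ∧
    ∀ x : ℝ → State n d, IsSolution G f x₀ x → ∀ t : ℝ, 0 ≤ t → x t ∈ S

/-- `A` is globally uniformly asymptotically stable relative to the forward invariant compact set
`S ⊆ (𝕊ᵈ⁻¹)ⁿ`; the distance to `A` is that of `ℝⁿᵈ`. -/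
def GloballyUniformlyAsymptoticallyStable {n d : ℕ} (G : SwitchingDigraph n)
    (f : Fin n → Fin n → ℝ → ℝ) (A S : Set (State n d)) : Prop :=
  S ⊆ power n (unitSphere d) ∧ IsCompact S ∧ ForwardInvariant G f S ∧
  (∀ ε : ℝ, 0 < ε → ∃ T : ℝ, 0 < T ∧ ∀ x₀ ∈ S, ∀ x : ℝ → State n d, IsSolution G f x₀ x →
    Metric.infDist (x T) A ≤ ε) ∧
  (∀ ε : ℝ, 0 < ε → ∃ δ : ℝ, 0 < δ ∧ ∀ x₀ ∈ S, Metric.infDist x₀ A ≤ δ →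
    ∀ x : ℝ → State n d, IsSolution G f x₀ x → ∀ t : ℝ, 0 ≤ t → Metric.infDist (x t) A ≤ ε)

/-! ### Balls and hemispheres -/

/-- The open hemisphere with pole `v`. -/
def openHemisphere {d : ℕ} (v : EuclideanSpace ℝ (Fin d)) : Set (EuclideanSpace ℝ (Fin d)) :=
  {w | w ∈ unitSphere d ∧ 0 < inner ℝ w v}

/-- The closed ball on the unit sphere with centre `c` and (chordal) radius `r`. -/
def sphereClosedBall {d : ℕ} (c : EuclideanSpace ℝ (Fin d)) (r : ℝ) :
    Set (EuclideanSpace ℝ (Fin d)) :=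
  {y | y ∈ unitSphere d ∧ ‖y - c‖ ≤ r}

end SphereConsensus

end

/-!
Let `c` be the centre of the ball. A closed ball inside an open hemisphere is a cap
`{y | κ ≤ ⟪y, c⟫}` of the sphere with `κ > 0` (`exists_sphereClosedBall_eq_sphericalCap`), and such
caps are forward invariant: an agent with the smallest inner product with `c` is never driven
further away from `c` (`mem_power_sphericalCap_of_solution`). Since the neighbourhoods are locally
constant to the right and to the left of every time, solutions of the autonomous Lipschitz equations
can be glued to global ones inside the compact invariant set (`exists_global_solution`).

The gnomonic projection `y ↦ y / ⟪y, c⟫` straightens the dynamics: every coordinate of the projected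
agents follows a linear consensus equation `yᵢ' = ∑ⱼ aᵢⱼ (yⱼ - yᵢ)`. Its nonnegative weights are
bounded, and the weight of an active edge is bounded below while the coordinates of its ends are
apart (`isConsensusFlow_gnomonic`). The maximum of such a family does not increase and the minimum
does not decrease, which gives stability.

For uniform attraction, let `m ≤ yᵢ ≤ M` and call an agent low if it is at least `δ` below `M`, high
if it is at least `δ` above `m`; for `δ = (M - m) / 2` every agent is one or the other. By the
dwell time, every edge of a union graph is active during an interval of fixed length in a slightly
longer window. Low agents stay low and pull the agents that listen to them down, for a smaller `δ`
depending only on the data (`exists_window_gap`). The root of the window is low or high, so along a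
path to the root the low or the high set grows in every window, until all agents are low or all are
high (`exists_gap_growth`). Then `M - m` has decreased by a fixed amount in a fixed time, as long as
it was at least `ε` (`exists_spread_decrease`). The root may change from window to window, which is
why both sets are followed simultaneously.
-/

namespace SphereConsensus

/-! ### Comparison principles for right derivatives -/

open Set in
/-- Maximum principle for finitely many functions with right derivatives: if the largest of them
cannot increase while it is slightly above the level `L`, then none of them ever exceeds `L`. -/
theorem le_of_hasDerivWithinAt_nonpos_of_isMax {ι : Type*} [Finite ι] {y y' : ι → ℝ → ℝ}
    {a b L η : ℝ} (hη : 0 < η) (hc : ∀ i, ContinuousOn (y i) (Icc a b))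
    (hd : ∀ t ∈ Ico a b, ∀ i, HasDerivWithinAt (y i) (y' i t) (Ici t) t)
    (h0 : ∀ i, y i a ≤ L)
    (hm : ∀ t ∈ Ico a b, ∀ i, (∀ j, y j t ≤ y i t) → L < y i t → y i t < L + η → y' i t ≤ 0) :
    ∀ t ∈ Icc a b, ∀ i, y i t ≤ L := by
  -- Compare with the strictly increasing barrier `L + ε (1 + (t - a))` and let `ε → 0`.
  have key : ∀ ε > 0, ε * (1 + (b - a)) < η →
      Icc a b ⊆ {t | ∀ i, y i t ≤ L + ε * (1 + (t - a))} := by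
    intro ε hε hεη
    apply IsClosed.Icc_subset_of_forall_mem_nhdsWithin
    · have : {t | ∀ i, y i t ≤ L + ε * (1 + (t - a))} ∩ Icc a b =
          Icc a b ∩ ⋂ i, {t ∈ Icc a b | y i t ≤ L + ε * (1 + (t - a))} := by
        ext t; simp only [mem_inter_iff, mem_ofPred_eq, mem_iInter]; grind
      rw [this]
      exact isClosed_Icc.inter (isClosed_iInter fun i =>
        isClosed_Icc.isClosed_le (hc i) (by fun_prop))
    · intro i
      have := h0 i
      simp only [sub_self, add_zero, mul_one]; linarith
    · rintro t ⟨hs, ht⟩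
      change ∀ᶠ r in 𝓝[>] t, ∀ i, y i r ≤ L + ε * (1 + (r - a))
      rw [eventually_all]
      intro i
      have hdB : HasDerivWithinAt (fun r => y i r - (L + ε * (1 + (r - a)))) (y' i t - ε)
          (Ioi t) t := by
        have h1 : HasDerivAt (fun r : ℝ => L + ε * (1 + (r - a))) ε t := by
          simpa using ((((hasDerivAt_id t).sub_const a).const_add 1).const_mul ε).const_add L
        exact ((hd t ht i).mono Ioi_subset_Ici_self).sub h1.hasDerivWithinAt
      rcases (hs i).lt_or_eq with hlt | heq
      · have := hdB.continuousWithinAt.eventually_lt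
          (g := fun _ => (0 : ℝ)) continuousWithinAt_const (by simpa using hlt)
        filter_upwards [this] with r hr
        linarith
      · have hneg : y' i t - ε < 0 := by
          have h1 : ε * (1 + (t - a)) > 0 := mul_pos hε (by linarith [ht.1])
          have h2 : ε * (1 + (t - a)) ≤ ε * (1 + (b - a)) :=
            mul_le_mul_of_nonneg_left (by linarith [ht.2]) hε.le
          have := hm t ht i (fun j => heq ▸ hs j) (by linarith) (by linarith)
          linarith
        have hsl := (hasDerivWithinAt_iff_tendsto_slope' (by simp)).1 hdB
        filter_upwards [hsl.eventually_lt_const hneg, self_mem_nhdsWithin] with r hr hrt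
        rw [slope_def_field, heq, sub_self, sub_zero, div_neg_iff] at hr
        have : 0 < r - t := sub_pos.2 hrt
        rcases hr with h | h <;> linarith [h.1, h.2]
  intro t ht i
  refine le_of_forall_pos_le_add fun δ hδ => ?_
  have hab : 0 < 1 + (b - a) := by linarith [ht.1, ht.2]
  have hmin : 0 < min η δ := lt_min hη hδ
  set ε := min η δ / (2 * (1 + (b - a))) with hε
  have hεp : 0 < ε := by positivity
  have hεe : ε * (1 + (b - a)) = min η δ / 2 := by rw [hε]; field_simp
  have h1 := key ε hεp (by rw [hεe]; linarith [min_le_left η δ]) ht i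
  have h2 : ε * (1 + (t - a)) ≤ ε * (1 + (b - a)) :=
    mul_le_mul_of_nonneg_left (by linarith [ht.2]) hεp.le
  linarith [min_le_right η δ]

open Set in
/-- Integrated form of the differential inequality `u' ≥ c - C u`. -/
theorem le_of_sub_mul_le_hasDerivWithinAt {u u' : ℝ → ℝ} {a b C c : ℝ} (hC : 0 < C) (hab : a ≤ b)
    (hc : ContinuousOn u (Icc a b))
    (hd : ∀ t ∈ Ico a b, HasDerivWithinAt u (u' t) (Ici t) t)
    (hb : ∀ t ∈ Ico a b, c - C * u t ≤ u' t) :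
    u a * Real.exp (-C * (b - a)) + c / C * (1 - Real.exp (-C * (b - a))) ≤ u b := by
  have := le_gronwallBound_of_liminf_deriv_right_le (f := fun t => - u t) (f' := fun t => - u' t)
    (K := -C) (ε := -c) hc.neg
    (fun x hx r hr => (hd x hx).neg.liminf_right_slope_le hr) le_rfl
    (fun x hx => by have := hb x hx; linarith) b ⟨hab, le_rfl⟩
  rw [gronwallBound_of_K_ne_0 (by linarith)] at this
  have h2 : -c / -C = c / C := by rw [neg_div_neg_eq]
  simp only [h2] at this
  linarith

/-! ### Scalar consensus over switching digraphs -/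

/-- The functions `y i`, on `[0, ∞)`, follow a linear consensus dynamics `yᵢ' = ∑ⱼ aᵢⱼ (yⱼ - yᵢ)`
with time-varying weights in `[0, β]`. The weight of an active edge (`j ∈ N i t`) may degenerate
when `y i` and `y j` come together, but it is at least `η ρ` while they are `ρ` or more apart. -/
structure IsConsensusFlow {ι : Type*} [Fintype ι] (N : ι → ℝ → Finset ι) (β : ℝ) (η : ℝ → ℝ)
    (y : ι → ℝ → ℝ) : Prop where
  continuousOn : ∀ i, ContinuousOn (y i) (Set.Ici 0)
  exists_weights : ∀ t, 0 ≤ t → ∃ a : ι → ι → ℝ, (∀ i j, 0 ≤ a i j ∧ a i j ≤ β) ∧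
    (∀ i, ∀ j ∈ N i t, ∀ ρ, 0 < ρ → ρ ≤ |y j t - y i t| → η ρ ≤ a i j) ∧
    ∀ i, HasDerivWithinAt (y i) (∑ j, a i j * (y j t - y i t)) (Set.Ici t) t

/-- For every `t ≥ 0` there is a node reached from all nodes along edges that are each active during
some time interval of length `τ` inside `[t, t + T]`. -/
def WindowConnected {ι : Type*} (N : ι → ℝ → Finset ι) (T τ : ℝ) : Prop :=
  ∀ t, 0 ≤ t → ∃ r, ∀ i, Relation.ReflTransGen
    (fun i j => ∃ p, t ≤ p ∧ p + τ ≤ t + T ∧ ∀ s ∈ Set.Ico p (p + τ), j ∈ N i s) i r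

namespace IsConsensusFlow

variable {ι : Type*} [Fintype ι] {N : ι → ℝ → Finset ι} {β : ℝ} {η : ℝ → ℝ} {y : ι → ℝ → ℝ}

theorem neg (h : IsConsensusFlow N β η y) : IsConsensusFlow N β η (fun i t => - y i t) where
  continuousOn i := (h.continuousOn i).neg
  exists_weights t ht := by
    obtain ⟨a, ha, hl, hd⟩ := h.exists_weights t ht
    refine ⟨a, ha, fun i j hj ρ hρ hle => hl i j hj ρ hρ ?_, fun i => ?_⟩
    · rwa [← abs_neg, show -(y j t - y i t) = -y j t - -y i t by ring]
    · refine (hd i).neg.congr_deriv ?_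
      rw [← Finset.sum_neg_distrib]
      exact Finset.sum_congr rfl fun j _ => by ring

theorem le_of_le (h : IsConsensusFlow N β η y) {s t M : ℝ} (hs : 0 ≤ s) (hst : s ≤ t)
    (hM : ∀ i, y i s ≤ M) (i : ι) : y i t ≤ M := by
  choose! a ha _ hd using h.exists_weights
  refine le_of_hasDerivWithinAt_nonpos_of_isMax (ι := ι) (y := y) (a := s) (b := t) one_pos
    (fun i => (h.continuousOn i).mono fun r hr => hs.trans hr.1)
    (fun r hr i => hd r (hs.trans hr.1) i) hM ?_ t ⟨hst, le_rfl⟩ i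
  intro r hr i hmax _ _
  exact Finset.sum_nonpos fun j _ =>
    mul_nonpos_of_nonneg_of_nonpos (ha r (hs.trans hr.1) i j).1 (sub_nonpos.2 (hmax j))

theorem ge_of_ge (h : IsConsensusFlow N β η y) {s t m : ℝ} (hs : 0 ≤ s) (hst : s ≤ t)
    (hm : ∀ i, m ≤ y i s) (i : ι) : m ≤ y i t :=
  neg_le_neg_iff.1 (h.neg.le_of_le hs hst (fun i => neg_le_neg (hm i)) i)

/-- A gap below an upper bound decays at most exponentially. -/
theorem gap_decay [Nonempty ι] (hβ : 0 < β) (h : IsConsensusFlow N β η y) {s t M : ℝ}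
    (hs : 0 ≤ s) (hst : s ≤ t) (hM : ∀ i, y i s ≤ M) (i : ι) :
    (M - y i s) * Real.exp (-(Fintype.card ι * β) * (t - s)) ≤ M - y i t := by
  choose! a ha _ hd using h.exists_weights
  have hC : 0 < (Fintype.card ι : ℝ) * β := by positivity
  have := le_of_sub_mul_le_hasDerivWithinAt (u := fun t => M - y i t) (c := 0) hC hst
    (continuousOn_const.sub ((h.continuousOn i).mono fun r hr => hs.trans hr.1))
    (fun r hr => (hd r (hs.trans hr.1) i).const_sub M) ?_
  · simpa using this
  intro r hr
  have hr0 : 0 ≤ r := hs.trans hr.1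
  have hMr : ∀ j, y j r ≤ M := h.le_of_le hs hr.1 hM
  rw [zero_sub, neg_le_neg_iff, mul_assoc, ← nsmul_eq_mul, Fintype.card, ← Finset.sum_const]
  refine Finset.sum_le_sum fun j _ => ?_
  calc a r i j * (y j r - y i r) ≤ a r i j * (M - y i r) :=
        mul_le_mul_of_nonneg_left (by linarith [hMr j]) (ha r hr0 i j).1
    _ ≤ β * (M - y i r) :=
        mul_le_mul_of_nonneg_right (ha r hr0 i j).2 (by linarith [hMr i])

/-- If `j` is an active neighbour of `i` and stays `δ` below the upper bound `M`, then `i` is pulled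
below `M` by an amount that depends only on `δ`, the elapsed time and the weight bounds. -/
theorem gap_of_active_edge [Nonempty ι] (hβ : 0 < β) (h : IsConsensusFlow N β η y)
    {p q M δ : ℝ} (hp : 0 ≤ p) (hpq : p ≤ q) (hM : ∀ i, y i p ≤ M) {i j : ι} (hδ : 0 < δ)
    (hj : ∀ s ∈ Set.Icc p q, y j s ≤ M - δ) (hN : ∀ s ∈ Set.Ico p q, j ∈ N i s) :
    min (δ / 2 * Real.exp (-(Fintype.card ι * β) * (q - p)))
      (η (δ / 2) * (δ / 2) / (Fintype.card ι * β) *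
        (1 - Real.exp (-(Fintype.card ι * β) * (q - p)))) ≤ M - y i q := by
  classical
  have hC : 0 < (Fintype.card ι : ℝ) * β := by positivity
  by_cases hcase : ∃ s ∈ Set.Icc p q, δ / 2 ≤ M - y i s
  · obtain ⟨s, hs, hsδ⟩ := hcase
    refine (min_le_left _ _).trans ?_
    refine le_trans ?_ (h.gap_decay hβ (hp.trans hs.1) hs.2 (h.le_of_le hp hs.1 hM) i)
    refine mul_le_mul hsδ (Real.exp_le_exp.2 ?_) (Real.exp_nonneg _) (by linarith)
    nlinarith [hs.1]
  · push Not at hcase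
    refine (min_le_right _ _).trans ?_
    choose! a ha hl hd using h.exists_weights
    have := le_of_sub_mul_le_hasDerivWithinAt (u := fun t => M - y i t)
      (c := η (δ / 2) * (δ / 2)) hC hpq
      (continuousOn_const.sub ((h.continuousOn i).mono fun r hr => hp.trans hr.1))
      (fun r hr => (hd r (hp.trans hr.1) i).const_sub M) ?_
    · refine le_trans ?_ this
      have h0 : 0 ≤ (M - y i p) * Real.exp (-(Fintype.card ι * β) * (q - p)) :=
        mul_nonneg (by linarith [hM i]) (Real.exp_nonneg _)
      linarith
    intro r hr
    have hr0 : 0 ≤ r := hp.trans hr.1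
    have hMr : ∀ j, y j r ≤ M := h.le_of_le hp hr.1 hM
    have hjr := hj r ⟨hr.1, hr.2.le⟩
    have hir := hcase r ⟨hr.1, hr.2.le⟩
    have haη : η (δ / 2) ≤ a r i j := by
      refine hl r hr0 i j (hN r hr) _ (by linarith) ?_
      rw [abs_sub_comm]
      exact le_trans (by linarith) (le_abs_self _)
    -- The `j`-th summand supplies the gain, the other ones cost at most `β (M - yᵢ)` each.
    have hsum : ∑ k, a r i k * (y k r - y i r) ≤
        ∑ k, (β * (M - y i r) - if k = j then η (δ / 2) * (δ / 2) else 0) := by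
      refine Finset.sum_le_sum fun k _ => ?_
      split_ifs with hk
      · subst hk
        have h1 : η (δ / 2) * (δ / 2) ≤ a r i k * (y i r - y k r) :=
          mul_le_mul haη (by linarith) (by linarith) (ha r hr0 i k).1
        have h2 : 0 ≤ β * (M - y i r) := mul_nonneg hβ.le (by linarith [hMr i])
        linarith
      · rw [sub_zero]
        calc a r i k * (y k r - y i r) ≤ a r i k * (M - y i r) :=
              mul_le_mul_of_nonneg_left (by linarith [hMr k]) (ha r hr0 i k).1
          _ ≤ β * (M - y i r) :=
              mul_le_mul_of_nonneg_right (ha r hr0 i k).2 (by linarith [hMr i])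
    rw [Finset.sum_sub_distrib, Finset.sum_const, Finset.sum_ite_eq' Finset.univ j,
      if_pos (Finset.mem_univ j), nsmul_eq_mul, Finset.card_univ] at hsum
    linarith

end IsConsensusFlow

section Convergence

variable {ι : Type*} [Fintype ι] {N : ι → ℝ → Finset ι} {β : ℝ} {η : ℝ → ℝ} {T τ : ℝ}

/-- Over one time window, nodes that are `δ` below the upper bound stay `δ'` below it, and they pull
every node with an active edge to them `δ'` below it. -/
theorem exists_window_gap [Nonempty ι] (hβ : 0 < β) (hη : ∀ ρ, 0 < ρ → 0 < η ρ) (hT : 0 < T)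
    (hτ : 0 < τ) {δ : ℝ} (hδ : 0 < δ) :
    ∃ δ', 0 < δ' ∧ δ' ≤ δ ∧ ∀ y, IsConsensusFlow N β η y → ∀ t, 0 ≤ t → ∀ M, (∀ i, y i t ≤ M) →
      (∀ i, y i t ≤ M - δ → y i (t + T) ≤ M - δ') ∧
      ∀ i j, y j t ≤ M - δ →
        (∃ p, t ≤ p ∧ p + τ ≤ t + T ∧ ∀ s ∈ Set.Ico p (p + τ), j ∈ N i s) →
        y i (t + T) ≤ M - δ' := by
  set C : ℝ := Fintype.card ι * β with hCdef
  have hC : 0 < C := by positivity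
  set E := Real.exp (-C * T) with hE
  have hE0 : 0 < E := Real.exp_pos _
  have hE1 : E ≤ 1 := Real.exp_le_one_iff.2 (by nlinarith)
  set δ₁ := δ * E with hδ₁
  have hδ₁0 : 0 < δ₁ := by positivity
  have hη1 : 0 < η (δ₁ / 2) := hη _ (by linarith)
  set g := min (δ₁ / 2 * Real.exp (-C * τ))
    (η (δ₁ / 2) * (δ₁ / 2) / C * (1 - Real.exp (-C * τ))) with hg
  have hg0 : 0 < g := by
    have : Real.exp (-C * τ) < 1 := Real.exp_lt_one_iff.2 (by nlinarith)
    refine lt_min (by positivity) (mul_pos (by positivity) (by linarith))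
  have hδ₁δ : δ₁ ≤ δ := mul_le_of_le_one_right hδ.le hE1
  -- A gap present at a time `s` of the window shrinks at most by the factor `E` until its end.
  have hdecay : ∀ y, IsConsensusFlow N β η y → ∀ t, 0 ≤ t → ∀ M, (∀ i, y i t ≤ M) →
      ∀ s u, t ≤ s → s ≤ u → u ≤ t + T → ∀ i, ∀ x > 0, x ≤ M - y i s → x * E ≤ M - y i u := by
    intro y hy t ht M hM s u hts hsu hu i x hx hxs
    refine le_trans ?_ (hy.gap_decay hβ (ht.trans hts) hsu (hy.le_of_le ht hts hM) i)
    refine mul_le_mul hxs (Real.exp_le_exp.2 ?_) hE0.le (by linarith)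
    rw [← hCdef]
    nlinarith
  refine ⟨min δ₁ (g * E), lt_min hδ₁0 (by positivity), (min_le_left _ _).trans hδ₁δ, ?_⟩
  intro y hy t ht M hM
  constructor
  · intro i hi
    have := hdecay y hy t ht M hM t (t + T) le_rfl (by linarith) le_rfl i δ hδ (by linarith)
    linarith [min_le_left δ₁ (g * E)]
  · rintro i j hj ⟨p, htp, hpT, hN⟩
    have h1 := hy.gap_of_active_edge hβ (p := p) (q := p + τ) (M := M) (i := i) (j := j)
      (ht.trans htp) (by linarith) (hy.le_of_le ht htp hM) hδ₁0 (fun s hs => by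
        have := hdecay y hy t ht M hM t s le_rfl (htp.trans hs.1) (hs.2.trans hpT) j δ hδ
          (by linarith)
        linarith) hN
    rw [add_sub_cancel_left] at h1
    have := hdecay y hy t ht M hM (p + τ) (t + T) (by linarith) hpT le_rfl i g hg0 h1
    linarith [min_le_right δ₁ (g * E)]

/-- A path from outside a set to a point of the set has an edge entering the set. -/
theorem exists_edge_into {α : Type*} {E : α → α → Prop} {P : α → Prop} {a r : α}
    (h : Relation.ReflTransGen E a r) (hr : P r) (ha : ¬ P a) : ∃ u v, E u v ∧ ¬ P u ∧ P v := by
  induction h using Relation.ReflTransGen.head_induction_on with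
  | refl => exact absurd hr ha
  | @head b c hbc _ ih =>
    by_cases hc : P c
    · exact ⟨b, c, hbc, ha, hc⟩
    · exact ih hc

open Finset in
/-- Call a node low if it is at least `δ` below the upper bound `M`, and high if it is at least `δ`
above the lower bound `m`. If every node is low or high, then so is the root of each window; hence
in each window, with `δ` adjusted, the low nodes or the high nodes gain a new member, until all
nodes are low or all are high. -/
theorem exists_gap_growth [Nonempty ι] (hβ : 0 < β) (hη : ∀ ρ, 0 < ρ → 0 < η ρ) (hT : 0 < T)
    (hτ : 0 < τ) (hN : WindowConnected N T τ) {δ : ℝ} (hδ : 0 < δ) (k : ℕ) :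
    ∃ δ', 0 < δ' ∧ δ' ≤ δ ∧ ∀ y, IsConsensusFlow N β η y → ∀ t, 0 ≤ t → ∀ m M,
      (∀ i, m ≤ y i t) → (∀ i, y i t ≤ M) → (∀ i, y i t ≤ M - δ ∨ m + δ ≤ y i t) →
      (∀ i, y i (t + k * T) ≤ M - δ') ∨ (∀ i, m + δ' ≤ y i (t + k * T)) ∨
      ((∀ i, y i (t + k * T) ≤ M - δ' ∨ m + δ' ≤ y i (t + k * T)) ∧
        k ≤ #{i | y i (t + k * T) ≤ M - δ'} + #{i | m + δ' ≤ y i (t + k * T)}) := by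
  induction k with
  | zero =>
    refine ⟨δ, hδ, le_rfl, fun y _ t _ m M _ _ h => Or.inr (Or.inr ⟨?_, Nat.zero_le _⟩)⟩
    simpa using h
  | succ k ih =>
    obtain ⟨δ₁, hδ₁, hδ₁δ, h1⟩ := ih
    obtain ⟨δ₂, hδ₂, hδ₂δ₁, h2⟩ := exists_window_gap (N := N) hβ hη hT hτ hδ₁
    refine ⟨δ₂, hδ₂, hδ₂δ₁.trans hδ₁δ, fun y hy t ht m M hm hM hlh => ?_⟩
    have hkT : 0 ≤ (k : ℝ) * T := by positivity
    set s := t + k * T with hs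
    have hs0 : 0 ≤ s := by linarith
    have hms : ∀ i, m ≤ y i s := hy.ge_of_ge ht (by linarith) hm
    have hMs : ∀ i, y i s ≤ M := hy.le_of_le ht (by linarith) hM
    have hsT : t + ((k + 1 : ℕ) : ℝ) * T = s + T := by push_cast; ring
    rw [hsT]
    obtain ⟨lowStay, lowEdge⟩ := h2 y hy s hs0 M hMs
    have hneg := h2 _ hy.neg s hs0 (-m) (fun i => neg_le_neg (hms i))
    have highStay : ∀ i, m + δ₁ ≤ y i s → m + δ₂ ≤ y i (s + T) := fun i hi => by
      have := hneg.1 i (by linarith)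
      linarith
    have highEdge : ∀ i j, m + δ₁ ≤ y j s →
        (∃ p, s ≤ p ∧ p + τ ≤ s + T ∧ ∀ s ∈ Set.Ico p (p + τ), j ∈ N i s) →
        m + δ₂ ≤ y i (s + T) := fun i j hj hp => by
      have := hneg.2 i j (by linarith) hp
      linarith
    rcases h1 y hy t ht m M hm hM hlh with hlow | hhigh | ⟨hall, hcard⟩
    · exact Or.inl fun i => lowStay i (hlow i)
    · exact Or.inr (Or.inl fun i => highStay i (hhigh i))
    rw [← hs] at hcard
    have hLsub : ({i | y i s ≤ M - δ₁} : Finset ι) ⊆ ({i | y i (s + T) ≤ M - δ₂} : Finset ι) := by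
      intro i hi
      simp only [mem_filter, mem_univ, true_and] at hi ⊢
      exact lowStay i hi
    have hHsub : ({i | m + δ₁ ≤ y i s} : Finset ι) ⊆ ({i | m + δ₂ ≤ y i (s + T)} : Finset ι) := by
      intro i hi
      simp only [mem_filter, mem_univ, true_and] at hi ⊢
      exact highStay i hi
    have hall' : ∀ i, y i (s + T) ≤ M - δ₂ ∨ m + δ₂ ≤ y i (s + T) := fun i =>
      (hall i).imp (lowStay i) (highStay i)
    obtain ⟨r, hr⟩ := hN s hs0
    rcases hall r with hrl | hrh
    · by_cases hL : ∀ i, y i s ≤ M - δ₁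
      · exact Or.inl fun i => lowStay i (hL i)
      push Not at hL
      obtain ⟨i, hi⟩ := hL
      obtain ⟨u, w, huw, hu, hw⟩ :=
        exists_edge_into (P := fun i => y i s ≤ M - δ₁) (hr i) hrl (not_le.2 hi)
      refine Or.inr (Or.inr ⟨hall', ?_⟩)
      have hlt := card_lt_card ((ssubset_iff_of_subset hLsub).2
        ⟨u, by simpa using lowEdge u w hw huw, by simpa using hu⟩)
      have hle := card_le_card hHsub
      omega
    · by_cases hH : ∀ i, m + δ₁ ≤ y i s
      · exact Or.inr (Or.inl fun i => highStay i (hH i))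
      push Not at hH
      obtain ⟨i, hi⟩ := hH
      obtain ⟨u, w, huw, hu, hw⟩ :=
        exists_edge_into (P := fun i => m + δ₁ ≤ y i s) (hr i) hrh (not_le.2 hi)
      refine Or.inr (Or.inr ⟨hall', ?_⟩)
      have hlt := card_lt_card ((ssubset_iff_of_subset hHsub).2
        ⟨u, by simpa using highEdge u w hw huw, by simpa using hu⟩)
      have hle := card_le_card hLsub
      omega

/-- As long as the spread is at least `ε`, it shrinks by a fixed amount in a fixed time. -/
theorem exists_spread_decrease [Nonempty ι] (hβ : 0 < β) (hη : ∀ ρ, 0 < ρ → 0 < η ρ) (hT : 0 < T)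
    (hτ : 0 < τ) (hN : WindowConnected N T τ) {ε : ℝ} (hε : 0 < ε) :
    ∃ S γ : ℝ, 0 < S ∧ 0 < γ ∧ ∀ y, IsConsensusFlow N β η y → ∀ t, 0 ≤ t → ∀ m M,
      (∀ i, m ≤ y i t) → (∀ i, y i t ≤ M) → ε ≤ M - m →
      ∃ m' M', (∀ i, m' ≤ y i (t + S)) ∧ (∀ i, y i (t + S) ≤ M') ∧ M' - m' ≤ M - m - γ := by
  set k := 2 * Fintype.card ι + 1 with hk
  obtain ⟨γ, hγ, _, h⟩ := exists_gap_growth hβ hη hT hτ hN (half_pos hε) k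
  have hS : 0 < (k : ℝ) * T := by positivity
  refine ⟨k * T, γ, hS, hγ, fun y hy t ht m M hm hM hεm => ?_⟩
  have hm' := hy.ge_of_ge (t := t + k * T) ht (by linarith) hm
  have hM' := hy.le_of_le (t := t + k * T) ht (by linarith) hM
  rcases h y hy t ht m M hm hM (fun i => by
    rcases le_total (y i t) (M - ε / 2) with h | h
    · exact Or.inl h
    · exact Or.inr (by linarith)) with h1 | h1 | ⟨_, h1⟩
  · exact ⟨m, M - γ, hm', h1, by linarith⟩
  · exact ⟨m + γ, M, h1, hM', by linarith⟩
  · have h2 := Finset.card_le_univ ({i | y i (t + k * T) ≤ M - γ} : Finset ι)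
    have h3 := Finset.card_le_univ ({i | m + γ ≤ y i (t + k * T)} : Finset ι)
    omega

/-- Uniform convergence of consensus flows: the time needed to bring the spread below `ε` depends
on the flow only through the bound `D` of its initial spread. -/
theorem exists_time_spread_le [Nonempty ι] (hβ : 0 < β) (hη : ∀ ρ, 0 < ρ → 0 < η ρ) (hT : 0 < T)
    (hτ : 0 < τ) (hN : WindowConnected N T τ) {ε : ℝ} (hε : 0 < ε) (D : ℝ) :
    ∃ S : ℝ, 0 < S ∧ ∀ y, IsConsensusFlow N β η y → (∀ i j, y i 0 - y j 0 ≤ D) →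
      ∀ i j, y i S - y j S ≤ ε := by
  obtain ⟨S, γ, hS, hγ, h⟩ := exists_spread_decrease hβ hη hT hτ hN hε
  have step : ∀ k : ℕ, ∀ y, IsConsensusFlow N β η y → (∀ i j, y i 0 - y j 0 ≤ D) →
      ∃ m M, (∀ i, m ≤ y i (k * S)) ∧ (∀ i, y i (k * S) ≤ M) ∧ M - m ≤ max ε (D - k * γ) := by
    intro k y hy hD
    induction k with
    | zero =>
      obtain ⟨p, hp⟩ := Finite.exists_max fun i => y i 0
      obtain ⟨q, hq⟩ := Finite.exists_min fun i => y i 0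
      exact ⟨y q 0, y p 0, by simpa using hq, by simpa using hp, by simpa using Or.inr (hD p q)⟩
    | succ k ih =>
      obtain ⟨m, M, hm, hM, hmM⟩ := ih
      have hkS : 0 ≤ (k : ℝ) * S := by positivity
      have hsucc : ((k + 1 : ℕ) : ℝ) * S = k * S + S := by push_cast; ring
      rw [hsucc]
      rcases le_total (M - m) ε with hle | hle
      · exact ⟨m, M, hy.ge_of_ge hkS (by linarith) hm, hy.le_of_le hkS (by linarith) hM,
          hle.trans (le_max_left _ _)⟩
      · obtain ⟨m', M', hm', hM', hlt⟩ := h y hy _ hkS m M hm hM hle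
        refine ⟨m', M', hm', hM', ?_⟩
        push_cast
        rcases le_max_iff.1 hmM with h1 | h1
        · exact le_max_of_le_left (by linarith)
        · exact le_max_of_le_right (by linarith)
  obtain ⟨k, hk⟩ := exists_nat_ge ((D - ε) / γ)
  rw [div_le_iff₀ hγ] at hk
  refine ⟨(k + 1 : ℕ) * S, by positivity, fun y hy hD i j => ?_⟩
  obtain ⟨m, M, hm, hM, hmM⟩ := step (k + 1) y hy hD
  have : max ε (D - (k + 1 : ℕ) * γ) ≤ ε := by
    push_cast
    exact max_le le_rfl (by linarith)
  linarith [hm j, hM i]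

end Convergence

/-! ### Dwell times -/

namespace SwitchingDigraph

variable {n : ℕ} (G : SwitchingDigraph n)

theorem eq_of_forall_Ioo {i : Fin n} {a b : ℝ}
    (h : ∀ s ∈ Set.Ioo a b, ∀ᶠ r in 𝓝 s, G.N i r = G.N i s) {s s' : ℝ} (hs : s ∈ Set.Ioo a b)
    (hs' : s' ∈ Set.Ioo a b) : G.N i s = G.N i s' := by
  let _ : TopologicalSpace (Finset (Fin n)) := ⊥
  have : DiscreteTopology (Finset (Fin n)) := ⟨rfl⟩
  refine isPreconnected_Ioo.constant (fun r hr => ?_) hs hs'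
  exact (tendsto_nhds_of_eventually_eq (h r hr)).mono_left nhdsWithin_le_nhds

theorem eq_of_forall_Ioo_of_mem_Ico {i : Fin n} {a b : ℝ}
    (h : ∀ s ∈ Set.Ioo a b, ∀ᶠ r in 𝓝 s, G.N i r = G.N i s) {s : ℝ} (hs : s ∈ Set.Ico a b) :
    G.N i s = G.N i a := by
  rcases hs.1.eq_or_lt with rfl | has
  · rfl
  have h1 : ∀ᶠ r in 𝓝[>] a, G.N i r = G.N i a :=
    (G.right_continuous i a).filter_mono (nhdsWithin_mono _ Set.Ioi_subset_Ici_self)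
  obtain ⟨r, hr, hra⟩ := (h1.and (Ioo_mem_nhdsGT (has.trans hs.2))).exists
  rw [← hr]
  exact G.eq_of_forall_Ioo h ⟨has, hs.2⟩ hra

theorem exists_eq_Ico (t : ℝ) :
    ∃ ε > 0, ∀ s ∈ Set.Ico t (t + ε), ∀ i, G.N i s = G.N i t := by
  have h : ∀ᶠ s in 𝓝[≥] t, ∀ i, G.N i s = G.N i t :=
    eventually_all.2 fun i => G.right_continuous i t
  obtain ⟨u, hu, hsub⟩ := (mem_nhdsGE_iff_exists_Ico_subset).1 h
  exact ⟨u - t, sub_pos.2 hu, fun s hs => hsub (by simpa using hs)⟩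

theorem exists_eq_Ioo_left (t : ℝ) :
    ∃ ε > 0, ∀ s ∈ Set.Ioo (t - ε) t, ∀ s' ∈ Set.Ioo (t - ε) t, ∀ i, G.N i s = G.N i s' := by
  obtain ⟨τ, hτ, hd⟩ := G.dwell_time
  have h : ∀ i, ∃ ε > 0, ∀ s ∈ Set.Ioo (t - ε) t, ∀ᶠ r in 𝓝 s, G.N i r = G.N i s := by
    intro i
    by_cases hcase : ∃ s ∈ Set.Ioo (t - τ) t, ¬ ∀ᶠ r in 𝓝 s, G.N i r = G.N i s
    · obtain ⟨s, hs, hdisc⟩ := hcase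
      refine ⟨t - s, sub_pos.2 hs.2, fun r hr => ?_⟩
      by_contra hr'
      have := hd i s r (by linarith [hr.1]) hdisc hr'
      linarith [hr.2, hs.1]
    · push Not at hcase
      exact ⟨τ, hτ, fun s hs => hcase s hs⟩
  choose ε hε h using h
  obtain ⟨δ, hδ, hδε⟩ : ∃ δ > 0, ∀ i, δ ≤ ε i := by
    rcases isEmpty_or_nonempty (Fin n) with he | he
    · exact ⟨1, one_pos, fun i => he.elim i⟩
    · obtain ⟨i, hi⟩ := Finite.exists_min ε
      exact ⟨ε i, hε i, hi⟩
  exact ⟨δ, hδ, fun s hs s' hs' i => G.eq_of_forall_Ioo (h i)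
    ⟨by linarith [hs.1, hδε i], hs.2⟩ ⟨by linarith [hs'.1, hδε i], hs'.2⟩⟩

/-- By the dwell time condition an edge of a union graph is active during an interval of fixed
length, just before or just after the time at which it is observed. -/
theorem exists_windowConnected (hG : G.UniformlyQuasiStronglyConnected) :
    ∃ T τ : ℝ, 0 < T ∧ 0 < τ ∧ WindowConnected G.N T τ := by
  obtain ⟨T, hT, h⟩ := hG
  obtain ⟨τ₀, hτ₀, hd⟩ := G.dwell_time
  refine ⟨T + 2 * τ₀, τ₀ / 3, by linarith, by linarith, fun t _ => ?_⟩
  obtain ⟨r, hr⟩ := h (t + τ₀)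
  refine ⟨r, fun i => Relation.ReflTransGen.mono ?_ i r (hr i)⟩
  rintro i j ⟨s, hs, hj⟩
  by_cases hcase : ∀ d ∈ Set.Ioo s (s + τ₀ / 3), ∀ᶠ r in 𝓝 d, G.N i r = G.N i d
  · refine ⟨s, by linarith [hs.1], by linarith [hs.2], fun u hu => ?_⟩
    rwa [G.eq_of_forall_Ioo_of_mem_Ico hcase hu]
  · simp only [not_forall, exists_prop] at hcase
    obtain ⟨d, hds, hdisc⟩ := hcase
    refine ⟨s - τ₀ / 3, by linarith [hs.1], by linarith [hs.2], fun u hu => ?_⟩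
    have hno : ∀ v ∈ Set.Ioo (s - τ₀ / 2) d, ∀ᶠ r in 𝓝 v, G.N i r = G.N i v := by
      intro v hv
      by_contra hv'
      have := hd i v d hv.2 hv' hdisc
      linarith [hv.1, hds.2]
    rwa [G.eq_of_forall_Ioo hno (s := u) (s' := s) ⟨by linarith [hu.1], by linarith [hu.2, hds.1]⟩
      ⟨by linarith, hds.1⟩]

end SwitchingDigraph

/-! ### Global solutions of switching differential equations -/

section ODE

variable {E : Type*} [NormedAddCommGroup E] [NormedSpace ℝ E]

/-- `x` is continuous on `[a, b]` and solves `x' = F t x` on `[a, b)` with right derivatives. -/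
def IsRightSolutionOn (F : ℝ → E → E) (x : ℝ → E) (a b : ℝ) : Prop :=
  ContinuousOn x (Set.Icc a b) ∧
    ∀ t ∈ Set.Ico a b, HasDerivWithinAt x (F t (x t)) (Set.Ici t) t

/-- From every point of `K` at time `a` there is a solution on `[a, b]`. -/
def SolvableOn (F : ℝ → E → E) (K : Set E) (a b : ℝ) : Prop :=
  ∀ y ∈ K, ∃ x, x a = y ∧ IsRightSolutionOn F x a b

/-- An autonomous locally Lipschitz equation is solvable for a time that is uniform over a compact
set of initial values. -/
theorem exists_uniform_time_solution [ProperSpace E] {g : E → E} (hg : LocallyLipschitz g)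
    {K : Set E} (hK : IsCompact K) :
    ∃ ε > 0, ∀ a b, a ≤ b → b ≤ a + ε → SolvableOn (fun _ => g) K a b := by
  obtain ⟨R, hR⟩ := hK.isBounded.subset_closedBall 0
  have hcpt : IsCompact (Metric.closedBall (0 : E) (R + 1)) := isCompact_closedBall _ _
  obtain ⟨L, hL⟩ := (hg.locallyLipschitzOn (s := Metric.closedBall 0 (R + 1)))
    |>.exists_lipschitzOnWith_of_compact hcpt
  obtain ⟨B, hB⟩ := hcpt.exists_bound_of_continuousOn hg.continuous.continuousOn
  have hB' : 0 < max B 1 := lt_max_of_lt_right one_pos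
  refine ⟨1 / max B 1, by positivity, fun a b hab hb y hy => ?_⟩
  have hsub : Metric.closedBall y ((1 : NNReal) : ℝ) ⊆ Metric.closedBall 0 (R + 1) := by
    apply Metric.closedBall_subset_closedBall'
    have := Metric.mem_closedBall.1 (hR hy)
    simp only [NNReal.coe_one]; linarith
  have hPL : IsPicardLindelof (fun _ => g) (tmin := a) (tmax := b) ⟨a, le_rfl, hab⟩ y 1 0
      (max B 1).toNNReal L :=
    { lipschitzOnWith := fun t _ => hL.mono hsub
      continuousOn := fun x _ => continuousOn_const
      norm_le := fun t _ x hx => (hB x (hsub hx)).trans ((le_max_left _ _).trans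
        (Real.le_coe_toNNReal _))
      mul_max_le := by
        simp only [sub_self, NNReal.coe_one, NNReal.coe_zero, sub_zero, Real.coe_toNNReal _ hB'.le]
        rw [max_eq_left (a := b - a) (by linarith), mul_comm, ← le_div_iff₀ hB']
        linarith }
  obtain ⟨α, hα, hd⟩ := hPL.exists_eq_forall_mem_Icc_hasDerivWithinAt₀
  refine ⟨α, hα, fun t ht => (hd t ht).continuousWithinAt, fun t ht => ?_⟩
  refine (hd t ⟨ht.1, ht.2.le⟩).mono_of_mem_nhdsWithin ?_
  filter_upwards [Icc_mem_nhdsGE ht.2] with s hs using ⟨ht.1.trans hs.1, hs.2⟩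

variable {F : ℝ → E → E} {K : Set E}

theorem IsRightSolutionOn.mono {x : ℝ → E} {a b a' b' : ℝ} (h : IsRightSolutionOn F x a b)
    (ha : a ≤ a') (hb : b' ≤ b) : IsRightSolutionOn F x a' b' :=
  ⟨h.1.mono (Set.Icc_subset_Icc ha hb), fun t ht => h.2 t ⟨ha.trans ht.1, ht.2.trans_le hb⟩⟩

theorem IsRightSolutionOn.hasDerivWithinAt_comp {E' : Type*} [NormedAddCommGroup E']
    [NormedSpace ℝ E'] {x : ℝ → E} {a b : ℝ} (h : IsRightSolutionOn F x a b) (L : E →L[ℝ] E')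
    {t : ℝ} (ht : t ∈ Set.Ico a b) :
    HasDerivWithinAt (fun s => L (x s)) (L (F t (x t))) (Set.Ici t) t :=
  L.hasFDerivAt.comp_hasDerivWithinAt t (h.2 t ht)

theorem IsRightSolutionOn.concat {x₁ x₂ : ℝ → E} {a b c : ℝ} (hab : a ≤ b) (hbc : b ≤ c)
    (h₁ : IsRightSolutionOn F x₁ a b) (h₂ : IsRightSolutionOn F x₂ b c) (h : x₁ b = x₂ b) :
    IsRightSolutionOn F (fun t => if t < b then x₁ t else x₂ t) a c := by
  have e₁ : Set.EqOn (fun t => if t < b then x₁ t else x₂ t) x₁ (Set.Icc a b) := by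
    intro t ht
    rcases ht.2.lt_or_eq with hlt | rfl
    · simp [hlt]
    · simp [h]
  have e₂ : Set.EqOn (fun t => if t < b then x₁ t else x₂ t) x₂ (Set.Ici b) := fun t ht =>
    if_neg (not_lt.2 ht)
  constructor
  · rw [← Set.Icc_union_Icc_eq_Icc hab hbc]
    exact (h₁.1.congr e₁).union_of_isClosed (h₂.1.congr (e₂.mono Set.Icc_subset_Ici_self))
      isClosed_Icc isClosed_Icc
  · intro t ht
    rcases lt_or_ge t b with hlt | hge
    · rw [e₁ ⟨ht.1, hlt.le⟩]
      refine (h₁.2 t ⟨ht.1, hlt⟩).congr_of_eventuallyEq ?_ (if_pos hlt)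
      filter_upwards [Ico_mem_nhdsGE hlt] with s hs using if_pos hs.2
    · rw [e₂ hge]
      exact (h₂.2 t ⟨hge, ht.2⟩).congr (fun s hs => e₂ (hge.trans hs)) (e₂ hge)

theorem SolvableOn.mono_right {a b c : ℝ} (h : SolvableOn F K a c) (hbc : b ≤ c) :
    SolvableOn F K a b := fun y hy =>
  let ⟨x, hx, hs⟩ := h y hy
  ⟨x, hx, hs.mono le_rfl hbc⟩

theorem SolvableOn.trans (hinv : ∀ a b x, a ≤ b → IsRightSolutionOn F x a b → x a ∈ K → x b ∈ K)
    {a b c : ℝ} (hab : a ≤ b) (hbc : b ≤ c) (h₁ : SolvableOn F K a b) (h₂ : SolvableOn F K b c) :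
    SolvableOn F K a c := by
  intro y hy
  obtain ⟨x₁, rfl, hs₁⟩ := h₁ y hy
  obtain ⟨x₂, hx₂, hs₂⟩ := h₂ (x₁ b) (hinv a b x₁ hab hs₁ hy)
  refine ⟨_, ?_, hs₁.concat hab hbc hs₂ hx₂.symm⟩
  rcases hab.lt_or_eq with hlt | rfl
  · simp [hlt]
  · simp [hx₂]

theorem solvableOn_self (a : ℝ) : SolvableOn F K a a := fun y _ =>
  ⟨fun _ => y, rfl, continuousOn_const, fun _ ht => absurd ht.2 (not_lt.2 ht.1)⟩

theorem solvableOn_of_autonomous [ProperSpace E] (hK : IsCompact K)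
    (hF : ∀ t, LocallyLipschitz (F t))
    (hinv : ∀ a b x, a ≤ b → IsRightSolutionOn F x a b → x a ∈ K → x b ∈ K) {a b : ℝ}
    (hab : a ≤ b) (hconst : ∀ s ∈ Set.Ico a b, F s = F a) : SolvableOn F K a b := by
  obtain ⟨ε, hε, h⟩ := exists_uniform_time_solution (hF a) hK
  have key : ∀ k : ℕ, SolvableOn F K a (min b (a + k * ε)) := by
    intro k
    induction k with
    | zero => simpa [hab] using solvableOn_self a
    | succ k ih =>
      have hkε : 0 ≤ (k : ℝ) * ε := by positivity
      have hle : min b (a + k * ε) ≤ min b (a + (k + 1 : ℕ) * ε) := by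
        push_cast
        exact min_le_min_left _ (by linarith)
      have hac : a ≤ min b (a + k * ε) := le_min hab (by linarith)
      refine ih.trans hinv hac hle fun y hy => ?_
      obtain ⟨x, hx, hc, hd⟩ := h _ _ hle (by
        push_cast
        rw [← min_add_add_right]
        exact min_le_min (by linarith) (by linarith)) y hy
      refine ⟨x, hx, hc, fun t ht => ?_⟩
      rw [hconst t ⟨hac.trans ht.1, ht.2.trans_le (min_le_left _ _)⟩]
      exact hd t ht
  obtain ⟨k, hk⟩ := exists_nat_ge ((b - a) / ε)
  rw [div_le_iff₀ hε] at hk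
  have := key k
  rwa [min_eq_left (by linarith)] at this

/-- Solvability up to any finite time, by continuous induction: the field does not change just
after nor just before any given time. -/
theorem solvableOn_of_switching [ProperSpace E] (hK : IsCompact K)
    (hF : ∀ t, LocallyLipschitz (F t))
    (hR : ∀ t, ∃ ε > 0, ∀ s ∈ Set.Ico t (t + ε), F s = F t)
    (hL : ∀ t, ∃ ε > 0, ∀ s ∈ Set.Ioo (t - ε) t, ∀ s' ∈ Set.Ioo (t - ε) t, F s = F s')
    (hinv : ∀ a b x, a ≤ b → IsRightSolutionOn F x a b → x a ∈ K → x b ∈ K) {a b : ℝ}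
    (hab : a ≤ b) : SolvableOn F K a b := by
  suffices Set.Icc a b ⊆ {t | SolvableOn F K a t} from this ⟨hab, le_rfl⟩
  apply IsClosed.Icc_subset_of_forall_exists_gt
  · refine isClosed_of_closure_subset fun t ht => ?_
    have htI : t ∈ Set.Icc a b :=
      isClosed_Icc.closure_subset (closure_mono Set.inter_subset_right ht)
    refine ⟨?_, htI⟩
    obtain ⟨ε, hε, hconst⟩ := hL t
    obtain ⟨s, ⟨hs, hsI⟩, hst⟩ := Metric.mem_closure_iff.1 ht ε hε
    rw [Real.dist_eq, abs_lt] at hst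
    rcases lt_or_ge s t with hlt | hge
    · exact SolvableOn.trans hinv hsI.1 hlt.le hs (solvableOn_of_autonomous hK hF hinv hlt.le
        fun r hr => hconst r ⟨by linarith [hr.1], hr.2⟩ s ⟨by linarith, hlt⟩)
    · exact SolvableOn.mono_right hs hge
  · exact solvableOn_self a
  · rintro t ⟨hs, ht⟩ u hu
    obtain ⟨ε, hε, hconst⟩ := hR t
    have htu : t < min u (t + ε) := lt_min hu (by linarith)
    refine ⟨min u (t + ε), ?_, htu, min_le_left _ _⟩
    exact SolvableOn.trans hinv ht.1 htu.le hs (solvableOn_of_autonomous hK hF hinv htu.le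
      fun r hr => hconst r ⟨hr.1, hr.2.trans_le (min_le_right _ _)⟩)

/-- A switching equation with locally Lipschitz fields and a compact forward invariant set `K` has
a solution on `[0, ∞)` from every point of `K`. -/
theorem exists_global_solution [ProperSpace E] (hK : IsCompact K)
    (hF : ∀ t, LocallyLipschitz (F t))
    (hR : ∀ t, ∃ ε > 0, ∀ s ∈ Set.Ico t (t + ε), F s = F t)
    (hL : ∀ t, ∃ ε > 0, ∀ s ∈ Set.Ioo (t - ε) t, ∀ s' ∈ Set.Ioo (t - ε) t, F s = F s')
    (hinv : ∀ a b x, a ≤ b → IsRightSolutionOn F x a b → x a ∈ K → x b ∈ K) {x₀ : E}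
    (hx₀ : x₀ ∈ K) :
    ∃ x : ℝ → E, x 0 = x₀ ∧ ContinuousOn x (Set.Ici 0) ∧ ∀ b, IsRightSolutionOn F x 0 b := by
  -- Solve on the intervals `[k, k + 1]` successively and glue.
  have hsol (k : ℕ) : SolvableOn F K k ((k + 1 : ℕ) : ℝ) :=
    solvableOn_of_switching hK hF hR hL hinv (by push_cast; linarith)
  choose! φ hφ0 hφ using hsol
  let y : ℕ → E := fun k => Nat.rec x₀ (fun k z => φ k z (k + 1 : ℕ)) k
  have hyK : ∀ k, y k ∈ K := by
    intro k
    induction k with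
    | zero => exact hx₀
    | succ k ih =>
      refine hinv k (k + 1 : ℕ) (φ k (y k)) (by push_cast; linarith) (hφ k _ ih) ?_
      rw [hφ0 k _ ih]
      exact ih
  let x : ℝ → E := fun t => φ ⌊t⌋₊ (y ⌊t⌋₊) t
  have hx : ∀ k : ℕ, Set.EqOn x (φ k (y k)) (Set.Icc (k : ℝ) (k + 1 : ℕ)) := by
    intro k t ht
    rcases ht.2.lt_or_eq with hlt | rfl
    · have : ⌊t⌋₊ = k := (Nat.floor_eq_iff ((Nat.cast_nonneg k).trans ht.1)).2
        ⟨ht.1, by exact_mod_cast hlt⟩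
      simp only [x, this]
    · simp only [x, Nat.floor_natCast]
      exact hφ0 (k + 1) _ (hyK (k + 1))
  have hderiv : ∀ t, 0 ≤ t → HasDerivWithinAt x (F t (x t)) (Set.Ici t) t := by
    intro t ht
    have hk : t ∈ Set.Ico (⌊t⌋₊ : ℝ) (⌊t⌋₊ + 1 : ℕ) :=
      ⟨Nat.floor_le ht, by push_cast; exact Nat.lt_floor_add_one t⟩
    have hxt := hx ⌊t⌋₊ ⟨hk.1, hk.2.le⟩
    rw [hxt]
    refine ((hφ _ _ (hyK _)).2 t hk).congr_of_eventuallyEq ?_ hxt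
    filter_upwards [Ico_mem_nhdsGE hk.2] with s hs using hx _ ⟨hk.1.trans hs.1, hs.2.le⟩
  suffices hcont : ContinuousOn x (Set.Ici 0) by
    refine ⟨x, ?_, hcont, fun b => ⟨hcont.mono Set.Icc_subset_Ici_self, fun t ht => hderiv t ht.1⟩⟩
    have h0 := hφ0 0 _ (hyK 0)
    rw [Nat.cast_zero] at h0
    exact (hx 0 (by simp)).trans h0
  intro t ht
  have hright := (hderiv t ht).continuousWithinAt
  rcases (show (0 : ℝ) ≤ t from ht).eq_or_lt with rfl | hpos
  · exact hright
  · refine (continuousAt_iff_continuous_left_right.2 ⟨?_, hright⟩).continuousWithinAt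
    obtain ⟨k, hk⟩ := Nat.exists_eq_succ_of_ne_zero (Nat.ceil_pos.2 hpos).ne'
    have h1 : t ≤ (k + 1 : ℕ) := by rw [← Nat.succ_eq_add_one, ← hk]; exact Nat.le_ceil t
    have h2 : (k : ℝ) < t := Nat.lt_ceil.1 (by omega)
    have hc : ContinuousWithinAt x (Set.Icc (k : ℝ) (k + 1 : ℕ)) t :=
      ((hφ k _ (hyK k)).1.congr (hx k)) t ⟨h2.le, h1⟩
    refine hc.mono_of_mem_nhdsWithin ?_
    filter_upwards [Icc_mem_nhdsLE h2] with s hs using ⟨hs.1, hs.2.trans h1⟩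

end ODE

/-! ### The closed-loop vector field -/

section VectorField

theorem _root_.LocallyLipschitz.smul_real {α E : Type*} [PseudoEMetricSpace α]
    [NormedAddCommGroup E] [NormedSpace ℝ E] {g : α → ℝ} {h : α → E} (hg : LocallyLipschitz g)
    (hh : LocallyLipschitz h) : LocallyLipschitz fun x => g x • h x :=
  (contDiff_smul (𝕜 := ℝ) (n := 1)).locallyLipschitz.comp (hg.prodMk hh)

theorem _root_.LocallyLipschitz.inner_real {α E : Type*} [PseudoEMetricSpace α]
    [NormedAddCommGroup E] [InnerProductSpace ℝ E] {g h : α → E} (hg : LocallyLipschitz g)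
    (hh : LocallyLipschitz h) : LocallyLipschitz fun x => inner ℝ (g x) (h x) :=
  (contDiff_inner (𝕜 := ℝ) (n := 1)).locallyLipschitz.comp (hg.prodMk hh)

theorem _root_.LocallyLipschitz.finset_sum {α E κ : Type*} [PseudoEMetricSpace α]
    [NormedAddCommGroup E] {s : Finset κ} {g : κ → α → E} (hg : ∀ k, LocallyLipschitz (g k)) :
    LocallyLipschitz fun x => ∑ k ∈ s, g k x := by
  classical
  induction s using Finset.induction_on with
  | empty => simpa using LocallyLipschitz.const (0 : E)
  | insert k s hk ih => simpa [Finset.sum_insert hk] using! (hg k).add ih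

theorem _root_.LocallyLipschitz.pi {α ι : Type*} [Fintype ι] {X : ι → Type*}
    [PseudoEMetricSpace α] [∀ i, PseudoEMetricSpace (X i)] {g : α → ∀ i, X i}
    (hg : ∀ i, LocallyLipschitz fun x => g x i) : LocallyLipschitz g := by
  intro x
  choose K t ht hK using fun i => hg i x
  refine ⟨Finset.univ.sup K, ⋂ i, t i, Filter.iInter_mem.2 ht, fun y hy z hz => ?_⟩
  rw [edist_pi_le_iff]
  intro i
  refine (hK i (Set.mem_iInter.1 hy i) (Set.mem_iInter.1 hz i)).trans ?_
  gcongr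
  exact Finset.le_sup (f := K) (Finset.mem_univ i)

variable {n d : ℕ} {f : Fin n → Fin n → ℝ → ℝ}

theorem locallyLipschitz_velocity (hf : ∀ i j, LocallyLipschitz (f i j))
    (N : Fin n → Finset (Fin n)) :
    LocallyLipschitz fun x : State n d =>
      (WithLp.toLp 2 fun i => velocity f (N i) x i : State n d) := by
  refine (PiLp.lipschitzWith_toLp 2 _).locallyLipschitz.comp (LocallyLipschitz.pi fun i => ?_)
  have hcoord : ∀ i, LocallyLipschitz fun x : State n d => x i := fun i =>
    (PiLp.proj (𝕜 := ℝ) 2 (fun _ : Fin n => EuclideanSpace ℝ (Fin d)) i).lipschitz.locallyLipschitz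
  have hsum : LocallyLipschitz fun x : State n d =>
      ∑ j ∈ N i, f i j ‖x j - x i‖ • (x j - x i) :=
    LocallyLipschitz.finset_sum fun j => (((hf i j).comp
      (lipschitzWith_one_norm.locallyLipschitz.comp ((hcoord j).sub (hcoord i))))).smul_real
        ((hcoord j).sub (hcoord i))
  exact hsum.sub (((hcoord i).inner_real hsum).smul_real (hcoord i))

theorem inner_velocity (Ni : Finset (Fin n)) (x : State n d) (i : Fin n) (hx : ‖x i‖ = 1)
    (e : EuclideanSpace ℝ (Fin d)) :
    inner ℝ (velocity f Ni x i) e =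
      ∑ j ∈ Ni, f i j ‖x j - x i‖ * (inner ℝ (x j) e - inner ℝ (x i) (x j) * inner ℝ (x i) e) := by
  rw [velocity, tangentProj, inner_sub_left, inner_smul_left, inner_sum, sum_inner, conj_trivial,
    Finset.sum_mul, ← Finset.sum_sub_distrib]
  refine Finset.sum_congr rfl fun j _ => ?_
  rw [inner_smul_left, inner_smul_right, inner_sub_left, inner_sub_right,
    real_inner_self_eq_norm_sq, hx, conj_trivial]
  ring

theorem inner_self_tangentProj (x y : EuclideanSpace ℝ (Fin d)) :
    inner ℝ x (tangentProj x y) = -(inner ℝ x y) * (‖x‖ ^ 2 - 1) := by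
  rw [tangentProj, inner_sub_right, inner_smul_right, real_inner_self_eq_norm_sq]
  ring

end VectorField

/-! ### Invariance of spherical caps -/

/-- The points of the unit sphere whose inner product with `c` is at least `κ`. -/
def sphericalCap {d : ℕ} (c : EuclideanSpace ℝ (Fin d)) (κ : ℝ) :
    Set (EuclideanSpace ℝ (Fin d)) :=
  {y | y ∈ unitSphere d ∧ κ ≤ inner ℝ y c}

/-- A closed ball inside an open hemisphere is a cap strictly inside the hemisphere around its own
centre: if `y` were in the ball with `⟪y, c⟫ ≤ 0`, then the reflection `2⟪y, c⟫c - y` of `y` would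
be in the ball as well, and the two points cannot both have positive inner product with `v`. -/
theorem exists_sphereClosedBall_eq_sphericalCap {d : ℕ} {v c : EuclideanSpace ℝ (Fin d)} {r : ℝ}
    (hc : c ∈ unitSphere d) (hB : sphereClosedBall c r ⊆ openHemisphere v) :
    ∃ κ > 0, sphereClosedBall c r = sphericalCap c κ := by
  have hc1 : ‖c‖ = 1 := hc
  have hmem : ∀ y, y ∈ sphereClosedBall c r ↔ ‖y‖ = 1 ∧ 0 ≤ r ∧ 2 - r ^ 2 ≤ 2 * inner ℝ y c := by
    intro y
    refine and_congr_right fun hy => ?_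
    have hy1 : ‖y‖ = 1 := hy
    have hsq : ‖y - c‖ ^ 2 = 2 - 2 * inner ℝ y c := by
      rw [norm_sub_sq_real, hy1, hc1]; ring
    constructor
    · intro h
      have hr : 0 ≤ r := (norm_nonneg _).trans h
      refine ⟨hr, ?_⟩
      have := pow_le_pow_left₀ (norm_nonneg _) h 2
      linarith
    · rintro ⟨hr, h⟩
      exact (sq_le_sq₀ (norm_nonneg _) hr).1 (by linarith)
  rcases lt_or_ge r 0 with hr | hr
  · -- Both sets are empty, as `⟪y, c⟫ ≤ 1` on the sphere.
    refine ⟨2, two_pos, ?_⟩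
    ext y
    rw [hmem]
    refine ⟨fun h => absurd h.2.1 (not_le.2 hr), fun h => ?_⟩
    have h1 : ‖y‖ = 1 := h.1
    have h2 := real_inner_le_norm y c
    have h3 := h.2
    rw [h1, hc1] at h2
    linarith
  have hcc : inner ℝ c c = (1 : ℝ) := by rw [real_inner_self_eq_norm_sq, hc1]; norm_num
  have hcB : c ∈ sphereClosedBall c r := (hmem c).2 ⟨hc1, hr, by rw [hcc]; nlinarith⟩
  have hpos : ∀ y ∈ sphereClosedBall c r, 0 < inner ℝ y c := by
    intro y hy
    by_contra hle
    have hy1 : ‖y‖ = 1 := hy.1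
    have hz : (2 * inner ℝ y c) • c - y ∈ sphereClosedBall c r := by
      rw [hmem] at hy ⊢
      have hin : inner ℝ ((2 * inner ℝ y c) • c - y) c = (inner ℝ y c : ℝ) := by
        rw [inner_sub_left, inner_smul_left, hcc, conj_trivial]; ring
      refine ⟨?_, hr, by rw [hin]; exact hy.2.2⟩
      have : ‖(2 * inner ℝ y c) • c - y‖ ^ 2 = 1 := by
        rw [norm_sub_sq_real, norm_smul, mul_pow, hc1, hy1, inner_smul_left, conj_trivial,
          real_inner_comm, Real.norm_eq_abs, sq_abs]
        rw [real_inner_comm]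
        ring
      exact (pow_eq_one_iff_of_nonneg (norm_nonneg _) two_ne_zero).1 this
    have h1 := (hB hy).2
    have h2 := (hB hz).2
    have h3 := (hB hcB).2
    rw [inner_sub_left, inner_smul_left, conj_trivial] at h2
    nlinarith
  have hcpt : IsCompact (sphereClosedBall c r) := by
    have : sphereClosedBall c r = Metric.sphere 0 1 ∩ Metric.closedBall c r := by
      ext y; simp [sphereClosedBall, unitSphere, dist_eq_norm]
    rw [this]
    exact (isCompact_sphere _ _).inter_right Metric.isClosed_closedBall
  obtain ⟨y₀, hy₀, hmin⟩ := hcpt.exists_isMinOn ⟨c, hcB⟩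
    (f := fun y => inner ℝ y c) (by fun_prop)
  refine ⟨inner ℝ y₀ c, hpos y₀ hy₀, ?_⟩
  ext y
  refine ⟨fun hy => ⟨hy.1, hmin hy⟩, fun hy => (hmem y).2 ⟨hy.1, hr, ?_⟩⟩
  have h1 := ((hmem y₀).1 hy₀).2.2
  have h2 := hy.2
  linarith

theorem isCompact_sphericalCap {d : ℕ} (c : EuclideanSpace ℝ (Fin d)) (κ : ℝ) :
    IsCompact (sphericalCap c κ) := by
  have : sphericalCap c κ = Metric.sphere 0 1 ∩ {y | κ ≤ inner ℝ y c} := by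
    ext y; simp [sphericalCap, unitSphere]
  rw [this]
  exact (isCompact_sphere _ _).inter_right (isClosed_le continuous_const (by fun_prop))

theorem isCompact_power {n d : ℕ} {B : Set (EuclideanSpace ℝ (Fin d))} (hB : IsCompact B) :
    IsCompact (power n B) := by
  have : power n B = WithLp.toLp 2 '' Set.univ.pi fun _ : Fin n => B := by
    ext x
    constructor
    · exact fun hx => ⟨WithLp.ofLp x, fun i _ => hx i, rfl⟩
    · rintro ⟨z, hz, rfl⟩ i
      exact hz i trivial
  rw [this]
  exact (isCompact_univ_pi fun _ => hB).image (PiLp.continuous_toLp 2 _)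

section Invariance

variable {n d : ℕ} {G : SwitchingDigraph n} {f : Fin n → Fin n → ℝ → ℝ} {x : ℝ → State n d}
  {a b : ℝ}

/-- The right-hand side is tangent to the spheres: `‖xᵢ‖² - 1` solves a linear equation. -/
theorem norm_eq_one_of_solution (hf : ∀ i j, Continuous (f i j))
    (hc : ContinuousOn x (Set.Icc a b))
    (hd : ∀ t ∈ Set.Ico a b, ∀ i,
      HasDerivWithinAt (fun s => x s i) (velocity f (G.N i t) (x t) i) (Set.Ici t) t)
    {i : Fin n} (h : ‖x a i‖ = 1) : ∀ t ∈ Set.Icc a b, ‖x t i‖ = 1 := by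
  have hci : ∀ i, ContinuousOn (fun t => x t i) (Set.Icc a b) := fun i =>
    (PiLp.continuous_apply 2 (fun _ : Fin n => EuclideanSpace ℝ (Fin d)) i).comp_continuousOn hc
  obtain ⟨B, hB⟩ := isCompact_Icc.exists_bound_of_continuousOn (s := Set.Icc a b)
    (f := fun t => ‖x t i‖ * ∑ j, |f i j ‖x t j - x t i‖| * ‖x t j - x t i‖)
    ((hci i).norm.mul (continuousOn_finsetSum _ fun j _ =>
      ((hf i j).comp_continuousOn ((hci j).sub (hci i)).norm).abs.mul ((hci j).sub (hci i)).norm))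
  have key := eq_zero_of_abs_deriv_le_mul_abs_self_of_eq_zero_right (K := 2 * B)
    (f := fun t => ‖x t i‖ ^ 2 - 1) (((hci i).norm.pow 2).sub continuousOn_const)
    (fun t ht => ((hd t ht i).norm_sq.sub_const 1)) (by rw [h]; norm_num) ?_
  · intro t ht
    have := key t ht
    exact (pow_eq_one_iff_of_nonneg (norm_nonneg _) two_ne_zero).1 (by linarith)
  · intro t ht
    rw [velocity, inner_self_tangentProj, norm_mul, norm_mul, norm_neg, ← mul_assoc]
    refine mul_le_mul_of_nonneg_right ?_ (norm_nonneg _)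
    rw [Real.norm_two]
    refine mul_le_mul_of_nonneg_left ?_ two_pos.le
    refine le_trans ?_ ((le_abs_self _).trans (hB t ⟨ht.1, ht.2.le⟩))
    refine (norm_inner_le_norm _ _).trans (mul_le_mul_of_nonneg_left ?_ (norm_nonneg _))
    refine (norm_sum_le _ _).trans ?_
    refine (Finset.sum_le_sum_of_subset_of_nonneg (Finset.subset_univ _)
      fun j _ _ => norm_nonneg _).trans (Finset.sum_le_sum fun j _ => ?_)
    rw [norm_smul, Real.norm_eq_abs]

/-- An agent with the smallest inner product with `c` is not driven away from `c`, as long as that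
inner product is nonnegative. Hence caps inside the hemisphere of pole `c` are invariant. -/
theorem mem_power_sphericalCap_of_solution (hf : ∀ i j, Continuous (f i j))
    (hf0 : ∀ i j s, 0 ≤ s → 0 ≤ f i j s) {c : EuclideanSpace ℝ (Fin d)} {κ : ℝ} (hκ : 0 < κ)
    (hc : ContinuousOn x (Set.Icc a b))
    (hd : ∀ t ∈ Set.Ico a b, ∀ i,
      HasDerivWithinAt (fun s => x s i) (velocity f (G.N i t) (x t) i) (Set.Ici t) t)
    (h : x a ∈ power n (sphericalCap c κ)) :
    ∀ t ∈ Set.Icc a b, x t ∈ power n (sphericalCap c κ) := by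
  have hnorm : ∀ i, ∀ t ∈ Set.Icc a b, ‖x t i‖ = 1 := fun i =>
    norm_eq_one_of_solution hf hc hd (h i).1
  have hci : ∀ i, ContinuousOn (fun t => x t i) (Set.Icc a b) := fun i =>
    (PiLp.continuous_apply 2 (fun _ : Fin n => EuclideanSpace ℝ (Fin d)) i).comp_continuousOn hc
  have key := le_of_hasDerivWithinAt_nonpos_of_isMax (a := a) (b := b) (L := -κ) (η := κ)
    (y := fun i t => -inner ℝ (x t i) c)
    (y' := fun i t => -inner ℝ (velocity f (G.N i t) (x t) i) c) hκ
    (fun i => ((hci i).inner continuousOn_const).neg)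
    (fun t ht i => by
      have := ((hd t ht i).inner ℝ (hasDerivWithinAt_const t (Set.Ici t) c)).neg
      simpa using! this)
    (fun i => neg_le_neg (h i).2) ?_
  · exact fun t ht i => ⟨hnorm i t ht, neg_le_neg_iff.1 (key t ht i)⟩
  · intro t ht i hmax _ hlt
    have htI : t ∈ Set.Icc a b := ⟨ht.1, ht.2.le⟩
    rw [inner_velocity _ _ _ (hnorm i t htI), neg_nonpos]
    refine Finset.sum_nonneg fun j _ => mul_nonneg (hf0 i j _ (norm_nonneg _)) ?_
    have h1 : inner ℝ (x t i) (x t j) ≤ (1 : ℝ) := by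
      have := real_inner_le_norm (x t i) (x t j)
      rwa [hnorm i t htI, hnorm j t htI, one_mul] at this
    have h2 := hmax j
    nlinarith

end Invariance

/-! ### Gnomonic coordinates -/

/-- The coordinate in direction `e` of the gnomonic projection `y / ⟪y, c⟫` of `y` from the origin
to the tangent space of the sphere at `c`. -/
noncomputable def gnomonic {d : ℕ} (c e y : EuclideanSpace ℝ (Fin d)) : ℝ :=
  inner ℝ y e / inner ℝ y c

section Gnomonic

variable {n d : ℕ} {c : EuclideanSpace ℝ (Fin d)} {κ : ℝ}

theorem abs_gnomonic_sub_le (hc : ‖c‖ = 1) (hκ : 0 < κ) {e x y : EuclideanSpace ℝ (Fin d)}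
    (he : ‖e‖ ≤ 1) (hx : x ∈ sphericalCap c κ) (hy : y ∈ sphericalCap c κ) :
    |gnomonic c e x - gnomonic c e y| ≤ 2 / κ ^ 2 * ‖x - y‖ := by
  have hx1 : ‖x‖ = 1 := hx.1
  have hy1 : ‖y‖ = 1 := hy.1
  have hzx : 0 < inner ℝ x c := hκ.trans_le hx.2
  have hzy : 0 < inner ℝ y c := hκ.trans_le hy.2
  have hprod : κ ^ 2 ≤ inner ℝ x c * inner ℝ y c := by
    rw [sq]; exact mul_le_mul hx.2 hy.2 hκ.le hzx.le
  have hnum : |inner ℝ x e * inner ℝ y c - inner ℝ x c * inner ℝ y e| ≤ 2 * ‖x - y‖ := by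
    have h1 : inner ℝ x e * inner ℝ y c - inner ℝ x c * inner ℝ y e =
        inner ℝ (x - y) e * inner ℝ y c - inner ℝ (x - y) c * inner ℝ y e := by
      rw [inner_sub_left, inner_sub_left]; ring
    have hle : ∀ u w : EuclideanSpace ℝ (Fin d), ‖w‖ ≤ 1 → |inner ℝ u w| ≤ ‖u‖ := fun u w hw =>
      (abs_real_inner_le_norm u w).trans (mul_le_of_le_one_right (norm_nonneg _) hw)
    have h2 : |inner ℝ (x - y) e * inner ℝ y c| ≤ ‖x - y‖ * 1 := by
      rw [abs_mul]
      exact mul_le_mul (hle _ _ he) ((hle _ _ hc.le).trans hy1.le) (abs_nonneg _) (norm_nonneg _)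
    have h3 : |inner ℝ (x - y) c * inner ℝ y e| ≤ ‖x - y‖ * 1 := by
      rw [abs_mul]
      exact mul_le_mul (hle _ _ hc.le) ((hle _ _ he).trans hy1.le) (abs_nonneg _) (norm_nonneg _)
    rw [h1]
    refine (abs_sub _ _).trans ?_
    linarith
  rw [gnomonic, gnomonic, div_sub_div _ _ hzx.ne' hzy.ne', abs_div, abs_of_pos (mul_pos hzx hzy),
    div_mul_eq_mul_div]
  exact div_le_div₀ (by positivity) hnum (by positivity) hprod

/-- The gnomonic coordinates along the standard basis control the distance on a hemisphere. -/
theorem norm_sub_le_of_gnomonic (hc : ‖c‖ = 1) (hκ : 0 < κ) {x y : EuclideanSpace ℝ (Fin d)}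
    (hx : x ∈ sphericalCap c κ) (hy : y ∈ sphericalCap c κ) {ε : ℝ}
    (h : ∀ k, |gnomonic c (EuclideanSpace.single k 1) x -
      gnomonic c (EuclideanSpace.single k 1) y| ≤ ε) : ‖x - y‖ ≤ 2 * d * ε := by
  have hx1 : ‖x‖ = 1 := hx.1
  have hy1 : ‖y‖ = 1 := hy.1
  have hzx : 0 < inner ℝ x c := hκ.trans_le hx.2
  have hzy : 0 < inner ℝ y c := hκ.trans_le hy.2
  have hzx1 : inner ℝ x c ≤ (1 : ℝ) := by
    have := real_inner_le_norm x c
    rwa [hx1, hc, one_mul] at this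
  set w := (inner ℝ x c : ℝ)⁻¹ • x - (inner ℝ y c : ℝ)⁻¹ • y with hw
  have hwn : ‖w‖ ≤ d * ε := by
    rw [← (EuclideanSpace.basisFun (Fin d) ℝ).sum_repr w]
    refine (norm_sum_le _ _).trans ?_
    have : (d : ℝ) * ε = ∑ _k : Fin d, ε := by simp
    rw [this]
    refine Finset.sum_le_sum fun k _ => ?_
    rw [norm_smul, OrthonormalBasis.norm_eq_one, mul_one, Real.norm_eq_abs]
    have hk : (EuclideanSpace.basisFun (Fin d) ℝ).repr w k =
        gnomonic c (EuclideanSpace.single k 1) x - gnomonic c (EuclideanSpace.single k 1) y := by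
      simp [hw, gnomonic, EuclideanSpace.inner_single_right, div_eq_inv_mul]
    rw [hk]
    exact h k
  -- With `z = ⟪·, c⟫` one has `x - y = z x • (w + (‖y / z y‖ - ‖x / z x‖) • y)`.
  have hid : x - y = (inner ℝ x c : ℝ) • w +
      (inner ℝ x c * ((inner ℝ y c : ℝ)⁻¹ - (inner ℝ x c : ℝ)⁻¹)) • y := by
    rw [hw, smul_sub, smul_smul, smul_smul, mul_inv_cancel₀ hzx.ne', one_smul, mul_sub,
      mul_inv_cancel₀ hzx.ne', sub_smul, one_smul]
    abel
  have hnn : |(inner ℝ y c : ℝ)⁻¹ - (inner ℝ x c : ℝ)⁻¹| ≤ ‖w‖ := by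
    have h1 := abs_norm_sub_norm_le ((inner ℝ x c : ℝ)⁻¹ • x) ((inner ℝ y c : ℝ)⁻¹ • y)
    rw [norm_smul, norm_smul, hx1, hy1, mul_one, mul_one, Real.norm_eq_abs, Real.norm_eq_abs,
      abs_of_pos (inv_pos.2 hzx), abs_of_pos (inv_pos.2 hzy)] at h1
    rwa [abs_sub_comm]
  have h1 : ‖x - y‖ ≤ inner ℝ x c * (‖w‖ + ‖w‖) := by
    rw [hid]
    refine (norm_add_le _ _).trans ?_
    rw [norm_smul, norm_smul, hy1, mul_one, norm_mul, Real.norm_eq_abs, abs_of_pos hzx,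
      Real.norm_eq_abs, ← mul_add]
    gcongr
  have h2 : inner ℝ x c * (‖w‖ + ‖w‖) ≤ 1 * (‖w‖ + ‖w‖) :=
    mul_le_mul_of_nonneg_right hzx1 (by positivity)
  linarith

/-- In gnomonic coordinates the closed-loop system becomes linear consensus with the state-dependent
weights `fᵢⱼ(‖xⱼ - xᵢ‖) ⟪xⱼ, c⟫ / ⟪xᵢ, c⟫`: the terms in `⟪xᵢ, xⱼ⟫` cancel. -/
theorem isConsensusFlow_gnomonic {G : SwitchingDigraph n} {f : Fin n → Fin n → ℝ → ℝ}
    (hf0 : ∀ i j s, 0 ≤ s → 0 ≤ f i j s) {β : ℝ} {η : ℝ → ℝ}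
    (hβ : ∀ i j s, 0 ≤ s → s ≤ 2 → f i j s ≤ β)
    (hη : ∀ ρ, 0 < ρ → ∀ i j s, ρ ≤ s → s ≤ 2 → η ρ ≤ f i j s)
    (hc : ‖c‖ = 1) (hκ : 0 < κ) {x₀ : State n d} {x : ℝ → State n d} (hx : IsSolution G f x₀ x)
    (hcap : ∀ t, 0 ≤ t → x t ∈ power n (sphericalCap c κ))
    {e : EuclideanSpace ℝ (Fin d)} (he : ‖e‖ ≤ 1) :
    IsConsensusFlow G.N (β * (1 / κ)) (fun ρ => η (ρ * (κ ^ 2 / 2)) * κ)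
      (fun i t => gnomonic c e (x t i)) := by
  have hci : ∀ i, ContinuousOn (fun t => x t i) (Set.Ici 0) := fun i =>
    (PiLp.continuous_apply 2 (fun _ : Fin n => EuclideanSpace ℝ (Fin d)) i).comp_continuousOn hx.2.1
  have hz : ∀ i t, 0 ≤ t → 0 < inner ℝ (x t i) c := fun i t ht => hκ.trans_le (hcap t ht i).2
  refine ⟨fun i => ((hci i).inner continuousOn_const).div ((hci i).inner continuousOn_const)
    fun t ht => (hz i t ht).ne', fun t ht => ?_⟩
  have hxn : ∀ i, ‖x t i‖ = 1 := fun i => (hcap t ht i).1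
  have hz1 : ∀ i, inner ℝ (x t i) c ≤ (1 : ℝ) := fun i => by
    have := real_inner_le_norm (x t i) c
    rwa [hxn, hc, one_mul] at this
  have hratio : ∀ i j, κ ≤ inner ℝ (x t j) c / inner ℝ (x t i) c ∧
      inner ℝ (x t j) c / inner ℝ (x t i) c ≤ 1 / κ := fun i j => by
    constructor
    · rw [le_div_iff₀ (hz i t ht)]
      exact (mul_le_of_le_one_right hκ.le (hz1 i)).trans (hcap t ht j).2
    · exact div_le_div₀ one_pos.le (hz1 j) hκ (hcap t ht i).2
  have hdist : ∀ i j, ‖x t j - x t i‖ ≤ 2 := fun i j =>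
    (norm_sub_le _ _).trans (by rw [hxn, hxn]; norm_num)
  have hw : ∀ i j, 0 ≤ f i j ‖x t j - x t i‖ * (inner ℝ (x t j) c / inner ℝ (x t i) c) ∧
      f i j ‖x t j - x t i‖ * (inner ℝ (x t j) c / inner ℝ (x t i) c) ≤ β * (1 / κ) := fun i j => by
    have h0 := hf0 i j _ (norm_nonneg (x t j - x t i))
    have h1 := hβ i j _ (norm_nonneg (x t j - x t i)) (hdist i j)
    exact ⟨mul_nonneg h0 (hκ.le.trans (hratio i j).1),
      mul_le_mul h1 (hratio i j).2 (hκ.le.trans (hratio i j).1) (h0.trans h1)⟩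
  refine ⟨fun i j => if j ∈ G.N i t then
    f i j ‖x t j - x t i‖ * (inner ℝ (x t j) c / inner ℝ (x t i) c) else 0,
    fun i j => ?_, fun i j hj ρ hρ hle => ?_, fun i => ?_⟩
  · beta_reduce
    split_ifs
    · exact hw i j
    · exact ⟨le_rfl, (hw i j).1.trans (hw i j).2⟩
  · beta_reduce
    rw [if_pos hj]
    have h1 := hle.trans (abs_gnomonic_sub_le hc hκ he (hcap t ht j) (hcap t ht i))
    have h2 : ρ * (κ ^ 2 / 2) ≤ ‖x t j - x t i‖ := by
      rw [div_mul_eq_mul_div, le_div_iff₀ (by positivity)] at h1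
      linarith
    exact mul_le_mul (hη _ (by positivity) i j _ h2 (hdist i j)) (hratio i j).1 hκ.le
      (hf0 i j _ (norm_nonneg _))
  · have hder : ∀ u : EuclideanSpace ℝ (Fin d), HasDerivWithinAt (fun s => inner ℝ (x s i) u)
        (inner ℝ (velocity f (G.N i t) (x t) i) u) (Set.Ici t) t := fun u => by
      have := (hx.2.2 t ht i).inner ℝ (hasDerivWithinAt_const t (Set.Ici t) u)
      simpa using! this
    refine ((hder e).div (hder c) (hz i t ht).ne').congr_deriv ?_
    simp only [ite_mul, zero_mul]
    rw [Finset.sum_ite_mem, Finset.univ_inter, inner_velocity _ _ _ (hxn i),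
      inner_velocity _ _ _ (hxn i), Finset.sum_mul, Finset.mul_sum, ← Finset.sum_sub_distrib,
      Finset.sum_div]
    refine Finset.sum_congr rfl fun j _ => ?_
    have h1 := (hz i t ht).ne'
    have h2 := (hz j t ht).ne'
    rw [gnomonic, gnomonic]
    field_simp
    ring

end Gnomonic

/-! ### Distance to the consensus set -/

section Distance

variable {n d : ℕ}

theorem infDist_consensusSet_le [Nonempty (Fin n)] {x : State n d} {ρ : ℝ} (hρ : 0 ≤ ρ)
    (hx : x ∈ power n (unitSphere d)) (h : ∀ i j, ‖x i - x j‖ ≤ ρ) :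
    Metric.infDist x (consensusSet n d) ≤ n * ρ := by
  obtain ⟨i₀⟩ := ‹Nonempty (Fin n)›
  have hmem : (WithLp.toLp 2 fun _ => x i₀ : State n d) ∈ consensusSet n d :=
    ⟨fun _ => hx i₀, fun _ _ => rfl⟩
  refine (Metric.infDist_le_dist_of_mem hmem).trans ?_
  have hn : (1 : ℝ) ≤ n := by exact_mod_cast (Fin.pos i₀)
  rw [dist_eq_norm]
  refine (sq_le_sq₀ (norm_nonneg _) (by positivity)).1 ?_
  rw [PiLp.norm_sq_eq_of_L2]
  calc ∑ i, ‖(x - (WithLp.toLp 2 fun _ => x i₀ : State n d)) i‖ ^ 2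
      ≤ ∑ _i : Fin n, ρ ^ 2 :=
        Finset.sum_le_sum fun i _ => pow_le_pow_left₀ (norm_nonneg _) (h i i₀) 2
    _ = n * ρ ^ 2 := by simp
    _ ≤ (n * ρ) ^ 2 := by
        rw [mul_pow]
        exact mul_le_mul_of_nonneg_right (by nlinarith) (sq_nonneg _)

theorem norm_sub_le_of_infDist_le {x : State n d} {δ : ℝ} (hδ : 0 < δ)
    (hne : (consensusSet n d).Nonempty) (h : Metric.infDist x (consensusSet n d) ≤ δ)
    (i j : Fin n) :
    ‖x i - x j‖ ≤ 4 * δ := by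
  obtain ⟨w, hw, hdist⟩ := (Metric.infDist_lt_iff hne).1 (h.trans_lt (by linarith : δ < 2 * δ))
  rw [dist_eq_norm] at hdist
  have hi : ‖x i - w i‖ ≤ ‖x - w‖ := PiLp.norm_apply_le (x - w) i
  have hj : ‖x j - w j‖ ≤ ‖x - w‖ := PiLp.norm_apply_le (x - w) j
  have : x i - x j = (x i - w i) - (x j - w j) := by rw [hw.2 i j]; abel
  rw [this]
  exact (norm_sub_le _ _).trans (by linarith)

end Distance

/-! ### Uniform bounds on the interaction functions -/

section Bounds

variable {n : ℕ} {f : Fin n → Fin n → ℝ → ℝ}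

theorem nonneg_of_pos_of_continuous (hf : ∀ i j, Continuous (f i j))
    (hpos : ∀ i j, ∀ s : ℝ, 0 < s → 0 < f i j s) (i j : Fin n) (s : ℝ) (hs : 0 ≤ s) :
    0 ≤ f i j s := by
  have hs' : s ∈ closure (Set.Ioi (0 : ℝ)) := by rwa [closure_Ioi]
  exact le_on_closure (f := fun _ => (0 : ℝ)) (fun t ht => (hpos i j t ht).le)
    continuousOn_const (hf i j).continuousOn hs'

theorem exists_upper_bound [Nonempty (Fin n)] (hf : ∀ i j, Continuous (f i j)) :
    ∃ β > 0, ∀ i j s, 0 ≤ s → s ≤ 2 → f i j s ≤ β := by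
  have h : ∀ p : Fin n × Fin n, ∃ B, ∀ s ∈ Set.Icc (0 : ℝ) 2, ‖f p.1 p.2 s‖ ≤ B := fun p =>
    isCompact_Icc.exists_bound_of_continuousOn (hf p.1 p.2).continuousOn
  choose B hB using h
  obtain ⟨p, hp⟩ := Finite.exists_max B
  exact ⟨max (B p) 1, lt_max_of_lt_right one_pos, fun i j s h0 h2 =>
    (le_abs_self _).trans ((hB (i, j) s ⟨h0, h2⟩).trans ((hp (i, j)).trans (le_max_left _ _)))⟩

theorem exists_lower_bound [Nonempty (Fin n)] (hf : ∀ i j, Continuous (f i j))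
    (hpos : ∀ i j, ∀ s : ℝ, 0 < s → 0 < f i j s) :
    ∃ η : ℝ → ℝ, (∀ ρ, 0 < ρ → 0 < η ρ) ∧
      ∀ ρ, 0 < ρ → ∀ i j s, ρ ≤ s → s ≤ 2 → η ρ ≤ f i j s := by
  have h : ∀ ρ : ℝ, 0 < ρ → ∃ m > 0, ∀ i j s, ρ ≤ s → s ≤ 2 → m ≤ f i j s := by
    intro ρ hρ
    have h1 : ∀ p : Fin n × Fin n, ∃ m > 0, ∀ s ∈ Set.Icc ρ 2, m ≤ f p.1 p.2 s := fun p =>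
      isCompact_Icc.exists_forall_le' (hf p.1 p.2).continuousOn
        fun s hs => hpos p.1 p.2 s (hρ.trans_le hs.1)
    choose m hm0 hm using h1
    obtain ⟨p, hp⟩ := Finite.exists_min m
    exact ⟨m p, hm0 p, fun i j s h1 h2 => (hp (i, j)).trans (hm (i, j) s ⟨h1, h2⟩)⟩
  choose! η hη0 hη using h
  exact ⟨η, hη0, hη⟩

end Bounds

/-! ### Stability of consensus relative to a cap -/

section Stability

variable {n d : ℕ} {G : SwitchingDigraph n} {f : Fin n → Fin n → ℝ → ℝ}
  {c : EuclideanSpace ℝ (Fin d)} {κ : ℝ}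

theorem forwardInvariant_power_sphericalCap (hf_lip : ∀ i j, ∃ K : NNReal, LipschitzWith K (f i j))
    (hf0 : ∀ i j s, 0 ≤ s → 0 ≤ f i j s) (hκ : 0 < κ) :
    ForwardInvariant G f (power n (sphericalCap c κ)) := by
  have hf : ∀ i j, Continuous (f i j) := fun i j => (hf_lip i j).choose_spec.continuous
  intro x₀ hx₀
  constructor
  · let F : ℝ → State n d → State n d := fun t x =>
      WithLp.toLp 2 fun i => velocity f (G.N i t) x i
    have hFeq : ∀ s t, (∀ i, G.N i s = G.N i t) → F s = F t := fun s t h => by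
      simp only [F, h]
    have hcomp : ∀ (x : ℝ → State n d) (a b : ℝ), IsRightSolutionOn F x a b → ∀ t ∈ Set.Ico a b,
        ∀ i, HasDerivWithinAt (fun s => x s i) (velocity f (G.N i t) (x t) i) (Set.Ici t) t :=
      fun x a b h t ht i => h.hasDerivWithinAt_comp
        (PiLp.proj (𝕜 := ℝ) 2 (fun _ : Fin n => EuclideanSpace ℝ (Fin d)) i) ht
    obtain ⟨x, hx0, hxc, hxd⟩ := exists_global_solution (F := F)
      (isCompact_power (isCompact_sphericalCap c κ))
      (fun t => locallyLipschitz_velocity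
        (fun i j => (hf_lip i j).choose_spec.locallyLipschitz) fun i => G.N i t)
      (fun t => by
        obtain ⟨ε, hε, h⟩ := G.exists_eq_Ico t
        exact ⟨ε, hε, fun s hs => hFeq _ _ (h s hs)⟩)
      (fun t => by
        obtain ⟨ε, hε, h⟩ := G.exists_eq_Ioo_left t
        exact ⟨ε, hε, fun s hs s' hs' => hFeq _ _ (h s hs s' hs')⟩)
      (fun a b x hab hx hxa => mem_power_sphericalCap_of_solution hf hf0 hκ hx.1
        (hcomp x a b hx) hxa b ⟨hab, le_rfl⟩) hx₀
    exact ⟨x, hx0, hxc, fun t ht => hcomp x 0 (t + 1) (hxd _) t ⟨ht, by linarith⟩⟩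
  · rintro x ⟨hx0, hxc, hxd⟩ t ht
    exact mem_power_sphericalCap_of_solution hf hf0 hκ (hxc.mono Set.Icc_subset_Ici_self)
      (fun s hs => hxd s hs.1) (by rwa [hx0]) t ⟨ht, le_rfl⟩

/-- Small spread of all gnomonic coordinates means small distance to consensus. -/
theorem infDist_le_of_gnomonic [Nonempty (Fin n)] (hc : ‖c‖ = 1) (hκ : 0 < κ) {x : State n d}
    (hx : x ∈ power n (sphericalCap c κ)) {ε : ℝ} (hε : 0 ≤ ε)
    (h : ∀ k i j, gnomonic c (EuclideanSpace.single k 1) (x i) -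
      gnomonic c (EuclideanSpace.single k 1) (x j) ≤ ε) :
    Metric.infDist x (consensusSet n d) ≤ n * (2 * d * ε) :=
  infDist_consensusSet_le (by positivity) (fun i => (hx i).1) fun i j =>
    norm_sub_le_of_gnomonic hc hκ (hx i) (hx j) fun k => abs_sub_le_iff.2 ⟨h k i j, h k j i⟩

theorem IsConsensusFlow.sub_le {ι : Type*} [Fintype ι] {N : ι → ℝ → Finset ι} {β : ℝ} {η : ℝ → ℝ}
    {y : ι → ℝ → ℝ} (h : IsConsensusFlow N β η y) {D t : ℝ} (hD : ∀ i j, y i 0 - y j 0 ≤ D)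
    (ht : 0 ≤ t) (i j : ι) : y i t - y j t ≤ D := by
  have : Nonempty ι := ⟨i⟩
  obtain ⟨p, hp⟩ := Finite.exists_max fun i => y i 0
  obtain ⟨q, hq⟩ := Finite.exists_min fun i => y i 0
  linarith [h.le_of_le le_rfl ht hp i, h.ge_of_ge le_rfl ht hq j, hD p q]

theorem globallyUniformlyAsymptoticallyStable_sphericalCap [Nonempty (Fin n)]
    (hG : G.UniformlyQuasiStronglyConnected)
    (hf_lip : ∀ i j, ∃ K : NNReal, LipschitzWith K (f i j))
    (hf_pos : ∀ i j, ∀ s : ℝ, 0 < s → 0 < f i j s) (hc : ‖c‖ = 1) (hκ : 0 < κ) :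
    GloballyUniformlyAsymptoticallyStable G f (consensusSet n d) (power n (sphericalCap c κ)) := by
  have hf : ∀ i j, Continuous (f i j) := fun i j => (hf_lip i j).choose_spec.continuous
  have hf0 := nonneg_of_pos_of_continuous hf hf_pos
  have hinv : ForwardInvariant G f (power n (sphericalCap c κ)) :=
    forwardInvariant_power_sphericalCap hf_lip hf0 hκ
  obtain ⟨β, hβ0, hβ⟩ := exists_upper_bound hf
  obtain ⟨η, hη0, hη⟩ := exists_lower_bound hf hf_pos
  obtain ⟨T, τ, hT, hτ, hN⟩ := G.exists_windowConnected hG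
  have hsingle : ∀ k : Fin d, ‖(EuclideanSpace.single k 1 : EuclideanSpace ℝ (Fin d))‖ ≤ 1 :=
    fun k => by simp
  have hflow : ∀ x₀ ∈ power n (sphericalCap c κ), ∀ x : ℝ → State n d, IsSolution G f x₀ x →
      ∀ k : Fin d, IsConsensusFlow G.N (β * (1 / κ)) (fun ρ => η (ρ * (κ ^ 2 / 2)) * κ)
        (fun i t => gnomonic c (EuclideanSpace.single k 1) (x t i)) := fun x₀ hx₀ x hx k =>
    isConsensusFlow_gnomonic hf0 hβ hη hc hκ hx ((hinv x₀ hx₀).2 x hx) (hsingle k)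
  refine ⟨fun x hx i => (hx i).1, isCompact_power (isCompact_sphericalCap c κ), hinv, ?_, ?_⟩
  · intro ε hε
    have hden : (0 : ℝ) < 2 * n * d + 1 := by positivity
    obtain ⟨S, hS, hconv⟩ := exists_time_spread_le (N := G.N) (β := β * (1 / κ))
      (η := fun ρ => η (ρ * (κ ^ 2 / 2)) * κ) (by positivity)
      (fun ρ hρ => mul_pos (hη0 _ (by positivity)) hκ) hT hτ hN
      (ε := ε / (2 * n * d + 1)) (by positivity) (2 / κ ^ 2 * 2)
    refine ⟨S, hS, fun x₀ hx₀ x hx => ?_⟩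
    refine (infDist_le_of_gnomonic hc hκ ((hinv x₀ hx₀).2 x hx S hS.le)
      (ε := ε / (2 * n * d + 1)) (by positivity)
      fun k => hconv _ (hflow x₀ hx₀ x hx k) fun i j => ?_).trans ?_
    · have h0 := (hinv x₀ hx₀).2 x hx 0 le_rfl
      refine (le_abs_self _).trans ((abs_gnomonic_sub_le hc hκ (hsingle k) (h0 i) (h0 j)).trans ?_)
      refine mul_le_mul_of_nonneg_left ((norm_sub_le _ _).trans ?_) (by positivity)
      have h1 : ‖x 0 i‖ = 1 := (h0 i).1
      have h2 : ‖x 0 j‖ = 1 := (h0 j).1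
      rw [h1, h2]; norm_num
    · rw [show (n : ℝ) * (2 * d * (ε / (2 * n * d + 1))) = 2 * n * d * ε / (2 * n * d + 1) by ring,
        div_le_iff₀ hden]
      linarith
  · intro ε hε
    have hden : (0 : ℝ) < 16 * n * d + 1 := by positivity
    refine ⟨ε * κ ^ 2 / (16 * n * d + 1), by positivity, fun x₀ hx₀ hdist x hx t ht => ?_⟩
    set δ := ε * κ ^ 2 / (16 * n * d + 1) with hδ
    have hδ0 : 0 < δ := by positivity
    have hne : (consensusSet n d).Nonempty :=
      ⟨WithLp.toLp 2 fun _ => c, fun _ => hc, fun _ _ => rfl⟩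
    refine (infDist_le_of_gnomonic hc hκ ((hinv x₀ hx₀).2 x hx t ht)
      (ε := 2 / κ ^ 2 * (4 * δ)) (by positivity)
      fun k => (hflow x₀ hx₀ x hx k).sub_le (fun i j => ?_) ht).trans ?_
    · have h0 := (hinv x₀ hx₀).2 x hx 0 le_rfl
      refine (le_abs_self _).trans ((abs_gnomonic_sub_le hc hκ (hsingle k) (h0 i) (h0 j)).trans ?_)
      rw [← hx.1] at hdist
      exact mul_le_mul_of_nonneg_left (norm_sub_le_of_infDist_le hδ0 hne hdist i j) (by positivity)
    · have : (n : ℝ) * (2 * d * (2 / κ ^ 2 * (4 * δ))) = 16 * n * d * ε / (16 * n * d + 1) := by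
        rw [hδ]; field_simp; ring
      rw [this, div_le_iff₀ hden]
      linarith

end Stability

end SphereConsensus

theorem proposition10 (n d : ℕ)
    (G : SphereConsensus.SwitchingDigraph n)
    (hG : G.UniformlyQuasiStronglyConnected)
    (f : Fin n → Fin n → ℝ → ℝ)
    (hf_lip : ∀ i j, ∃ K : NNReal, LipschitzWith K (f i j))
    (hf_pos : ∀ i j, ∀ s : ℝ, 0 < s → 0 < f i j s)
    (v : EuclideanSpace ℝ (Fin d)) (hv : v ∈ SphereConsensus.unitSphere d)
    (c : EuclideanSpace ℝ (Fin d)) (hc : c ∈ SphereConsensus.unitSphere d) (r : ℝ)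
    (hB : SphereConsensus.sphereClosedBall c r ⊆ SphereConsensus.openHemisphere v) :
    SphereConsensus.GloballyUniformlyAsymptoticallyStable G f
      (SphereConsensus.consensusSet n d)
      (SphereConsensus.power n (SphereConsensus.sphereClosedBall c r)) := by
  obtain ⟨κ, hκ, hcap⟩ := SphereConsensus.exists_sphereClosedBall_eq_sphericalCap hc hB
  obtain ⟨_, _, hroot⟩ := id hG
  have : Nonempty (Fin n) := ⟨(hroot 0).choose⟩
  rw [hcap]
  exact SphereConsensus.globallyUniformlyAsymptoticallyStable_sphericalCap hG hf_lip hf_pos hc hκ
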